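/- **Setting.** Let $E\subseteq\{1,\dots,N\}^2$ be the edge set of a directed graph on $\{1,\dots,N\}$, where $(j,i)$ is an edge from $j$ to $i$. Put $V_i=\{j:(j,i)\in E\}$, and let $p_i=|V_i|$ and $q_i$ be the in- and out-degree of $i$. Fix a parameter value $\rho$, real matrices $A(\rho)\in\mathbf R^{n\times n}$, $B_1,B_{20},B_{2i},C_{2i},D_{2i},H_{ij},G_{ij}$ of compatible sizes with $E_{2i}=D_{2i}D_{2i}'>0$ for all $i$ and $F_{ij}=G_{ij}G_{ij}'>0$ for $j\in V_i$, a matrix $R=R'\ge0$, and $\phi:\mathbf R^n\to\mathbf R^l$ with $\|\phi(a)-\phi(b)\|^2\le(a-b)'R(a-b)$ for all $a,b$. Let $\alpha,\gamma,\delta_1,\dots,\delta_N>0$ and let $Q_i=Q_i'>0$, $Q=\mathrm{diag}[Q_1,\dots,Q_N]$. Consider the leader $$\dot x=A(\rho)x+B_1\phi(x)+B_{20}w_0+\psi(t,x)$$ and the agents, $i=1,\dots,N$, $$\dot x_i=A(\rho)x_i+B_1\phi(x_i)+\psi(t,x_i)+u_i+B_{2i}w_i,$$ $$u_i=L_i(y_i-C_{2i}x_i)+\sum_{j\in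 V_i}K_{ij}(v_{ij}-H_{ij}x_i),\quad y_i=C_{2i}x+D_{2i}w_i,\quad v_{ij}=H_{ij}x_j+G_{ij}w_{ij},$$ where the mismatch $\psi$ satisfies $\|\psi(t,a)-\psi(t,b)\|^2\le\alpha^2\|a-b\|^2$ for all $t\ge0$ and all $a,b$ (such $\psi$ are called admissible). Solutions on $[0,\infty)$ are understood in the Carathéodory sense. Write $e_i=x-x_i$, $\mathbf e=[e_1'\ \dots\ e_N']'$ and $\Psi(\mathbf e)=\frac1N\sum_{i}\sum_{j\in V_i}\|e_j-e_i\|^2$. **Hypothesis.** Suppose that $\tau_i>0$, $\theta_i>0$, $X_i=X_i'>0$, $i=1,\dots,N$, satisfy the coupled LMIs $$\begin{bmatrix}S_i+\tau_iR+\theta_i\alpha^2I&T_i&X_i\\T_i'&-\Upsilon_i&0\\X_i&0&-\theta_iI\end{bmatrix}<0,\qquad i=1,\dots,N,$$ where, with $\hat A_i=A(\rho)+\delta_iI+B_{2i}D_{2i}'E_{2i}^{-1}C_{2i}$, $$S_i=X_i\hat A_i+\hat A_i'X_i+(p_i+q_i)I-\gamma^2C_{2i}'E_{2i}^{-1}C_{2i}-\gamma^2\sum_{j\in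 V_i}H_{ij}'F_{ij}^{-1}H_{ij}+Q_i,$$ $$T_i=\big[X_iB_{20},\ X_iB_{2i}(I-D_{2i}'E_{2i}^{-1}D_{2i}),\ X_iB_1,\ \Xi_i\big],\qquad \Upsilon_i=\mathrm{diag}[\gamma^2I,\gamma^2I,\tau_iI,Z_i],$$ $\Xi_i$ is the block row with blocks $\gamma^2H_{ij}'F_{ij}^{-1}H_{ij}-I$, $j\in V_i$, and $Z_i$ is the block diagonal matrix with blocks $\frac{2\delta_j}{q_j+1}X_j$, $j\in V_i$. **Conclusion.** Let the gains be $$K_{ij}=\gamma^2X_i^{-1}H_{ij}'F_{ij}^{-1},\qquad L_i=(\gamma^2X_i^{-1}C_{2i}'-B_{2i}D_{2i}')E_{2i}^{-1}.$$ Then the closed-loop network achieves strong robust synchronization with $P=\mathrm{diag}\big[\frac1{\gamma^2N}X_i\big]$; that is, $P=P'>0$ and: (i) there are $c,\omega>0$ such that for every admissible $\psi$ (in particular $\psi=0$) and every solution with all disturbances $w_0,w_i,w_{ij}$ zero, $\|e_i(t)\|^2\le c\,\|\mathbf e(0)\|^2e^{-\omega t}$ for all $t\ge0$ and all $i$; (ii)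 for every admissible $\psi$, all disturbances in $L_2[0,\infty)$ and every solution, the function $\frac1N\mathbf e'Q\mathbf e+\Psi(\mathbf e)$ is integrable on $[0,\infty)$ and $$\sup\frac{\int_0^\infty\big(\frac1N\mathbf e'Q\mathbf e+\Psi(\mathbf e)\big)dt}{\mathbf e(0)'P\,\mathbf e(0)+\|w_0\|_2^2+\frac1N\sum_{i=1}^N\big(\|w_i\|_2^2+\sum_{j=1}^N\|w_{ij}\|_2^2\big)}\le\gamma^2,$$ the supremum being over all initial states and disturbances for which the denominator is nonzero; (iii) for every admissible $\psi$, all disturbances in $L_2[0,\infty)$ and every solution, $\lim_{t\to\infty}\sum_{i=1}^N\|x(t)-x_i(t)\|^2=0$. If $\gamma\ge1$, the same holds with $P=\mathrm{diag}\big[\frac1NX_i\big]$. -/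

import Mathlib

open Set Filter Topology MeasureTheory
open scoped Matrix

noncomputable section

namespace SyncNetwork

/-- `ℝ^k` with the Euclidean norm. -/
abbrev Vec (k : ℕ) : Type := EuclideanSpace ℝ (Fin k)

/-- Matrix-vector product on Euclidean spaces. -/
def act {a b : ℕ} (M : Matrix (Fin a) (Fin b) ℝ) (v : Vec b) : Vec a :=
  WithLp.toLp 2 (M *ᵥ v.ofLp)

/-- The quadratic form `z' M z`. -/
def quad {ι : Type} [Fintype ι] (M : Matrix ι ι ℝ) (z : ι → ℝ) : ℝ :=
  z ⬝ᵥ (M *ᵥ z)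

/-- The stacked vector `[z_1' … z_N']'`; the entry `(a, i)` is the `a`-th coordinate of `z_i`. -/
def stack {N n : ℕ} (z : Fin N → Vec n) : Fin n × Fin N → ℝ := fun p => z p.2 p.1

/-- Data of the leader and of the `N` agents with states in `ℝ^n`. The dimensions are:
`l` for the nonlinearity, `r₀` and `r i` for the disturbances `w_0` and `w_i`,
`m i` for the measurement `y_i`, `s i j` for the channel disturbance `w_ij` and
`h i j` for the message `v_ij`. -/
structure Network (N n l r₀ : ℕ) (r m : Fin N → ℕ) (s h : Fin N → Fin N → ℕ) where
  /-- directed edges; `(j, i)` originates at `j` and ends at `i` -/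
  edges : Finset (Fin N × Fin N)
  /-- the parameter dependent state matrix -/
  A : ℝ → Matrix (Fin n) (Fin n) ℝ
  B₁ : Matrix (Fin n) (Fin l) ℝ
  B₂₀ : Matrix (Fin n) (Fin r₀) ℝ
  B₂ : ∀ i, Matrix (Fin n) (Fin (r i)) ℝ
  C₂ : ∀ i, Matrix (Fin (m i)) (Fin n) ℝ
  D₂ : ∀ i, Matrix (Fin (m i)) (Fin (r i)) ℝ
  H : ∀ i j, Matrix (Fin (h i j)) (Fin n) ℝ
  G : ∀ i j, Matrix (Fin (h i j)) (Fin (s i j)) ℝ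
  /-- the common nonlinearity -/
  φ : Vec n → Vec l

section

variable {N n l r₀ : ℕ} {r m : Fin N → ℕ} {s h : Fin N → Fin N → ℕ}

namespace Network

variable (net : Network N n l r₀ r m s h)

/-- The neighbourhood `V_i = {j : (j, i) ∈ E}`. -/
def nbr (i : Fin N) : Finset (Fin N) := Finset.univ.filter fun j => (j, i) ∈ net.edges

/-- The in-degree `p_i`. -/
def inDeg (i : Fin N) : ℕ := (net.nbr i).card

/-- The out-degree `q_i`. -/
def outDeg (i : Fin N) : ℕ := (Finset.univ.filter fun j => (i, j) ∈ net.edges).card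

/-- `E_{2i} = D_{2i} D_{2i}'`. -/
def E₂ (i : Fin N) : Matrix (Fin (m i)) (Fin (m i)) ℝ := net.D₂ i * (net.D₂ i)ᵀ

/-- `F_{ij} = G_{ij} G_{ij}'`. -/
def F (i j : Fin N) : Matrix (Fin (h i j)) (Fin (h i j)) ℝ := net.G i j * (net.G i j)ᵀ

/-- The disagreement function `Ψ_G`. -/
def disagreement (z : Fin N → Vec n) : ℝ :=
  1 / (N : ℝ) * ∑ i, ∑ j ∈ net.nbr i, ‖z j - z i‖ ^ 2

/-! ### The coupled linear matrix inequalities -/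

/-- The matrix `S_i(ρ)`. -/
def lmiS (ρ γ : ℝ) (δ : Fin N → ℝ) (Q X : Fin N → Matrix (Fin n) (Fin n) ℝ) (i : Fin N) :
    Matrix (Fin n) (Fin n) ℝ :=
  X i * (net.A ρ + δ i • (1 : Matrix (Fin n) (Fin n) ℝ)
      + net.B₂ i * (net.D₂ i)ᵀ * (net.E₂ i)⁻¹ * net.C₂ i)
    + (net.A ρ + δ i • (1 : Matrix (Fin n) (Fin n) ℝ)
      + net.B₂ i * (net.D₂ i)ᵀ * (net.E₂ i)⁻¹ * net.C₂ i)ᵀ * X i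
    + ((net.inDeg i : ℝ) + (net.outDeg i : ℝ)) • (1 : Matrix (Fin n) (Fin n) ℝ)
    - γ ^ 2 • ((net.C₂ i)ᵀ * (net.E₂ i)⁻¹ * net.C₂ i)
    - γ ^ 2 • ∑ j ∈ net.nbr i, (net.H i j)ᵀ * (net.F i j)⁻¹ * net.H i j
    + Q i

/-- The block row `Ξ_i`; its blocks `γ² H_ij' F_ij⁻¹ H_ij - I` are indexed by `j ∈ V_i`. -/
def lmiXi (γ : ℝ) (i : Fin N) : Matrix (Fin n) (Fin n × {j // j ∈ net.nbr i}) ℝ :=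
  Matrix.of fun a b =>
    (γ ^ 2 • ((net.H i b.2)ᵀ * (net.F i b.2)⁻¹ * net.H i b.2)
      - (1 : Matrix (Fin n) (Fin n) ℝ)) a b.1

/-- The block diagonal matrix `Z_i`, with blocks `2 δ_j / (q_j + 1) X_j`, `j ∈ V_i`. -/
def lmiZ (δ : Fin N → ℝ) (X : Fin N → Matrix (Fin n) (Fin n) ℝ) (i : Fin N) :
    Matrix (Fin n × {j // j ∈ net.nbr i}) (Fin n × {j // j ∈ net.nbr i}) ℝ :=
  Matrix.blockDiagonal fun j => (2 * δ j / ((net.outDeg j : ℝ) + 1)) • X j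

/-- Index type of the middle block row of the LMI. -/
abbrev MidIdx (i : Fin N) : Type :=
  Fin r₀ ⊕ (Fin (r i) ⊕ (Fin l ⊕ (Fin n × {j // j ∈ net.nbr i})))

/-- `T_i = [X_i B_20, X_i B_2i (I - D_2i' E_2i⁻¹ D_2i), X_i B_1, Ξ_i]`. -/
def lmiT (γ : ℝ) (X : Fin N → Matrix (Fin n) (Fin n) ℝ) (i : Fin N) :
    Matrix (Fin n) (net.MidIdx i) ℝ :=
  Matrix.fromCols (X i * net.B₂₀)
    (Matrix.fromCols
      (X i * net.B₂ i *
        ((1 : Matrix (Fin (r i)) (Fin (r i)) ℝ) - (net.D₂ i)ᵀ * (net.E₂ i)⁻¹ * net.D₂ i))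
      (Matrix.fromCols (X i * net.B₁) (net.lmiXi γ i)))

/-- `Υ_i = diag[γ² I, γ² I, τ_i I, Z_i]`. -/
def lmiUpsilon (γ : ℝ) (δ : Fin N → ℝ) (τ : Fin N → ℝ)
    (X : Fin N → Matrix (Fin n) (Fin n) ℝ) (i : Fin N) :
    Matrix (net.MidIdx i) (net.MidIdx i) ℝ :=
  Matrix.fromBlocks (γ ^ 2 • (1 : Matrix (Fin r₀) (Fin r₀) ℝ)) 0 0
    (Matrix.fromBlocks (γ ^ 2 • (1 : Matrix (Fin (r i)) (Fin (r i)) ℝ)) 0 0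
      (Matrix.fromBlocks (τ i • (1 : Matrix (Fin l) (Fin l) ℝ)) 0 0 (net.lmiZ δ X i)))

/-- The symmetric block matrix on the left-hand side of the `i`-th LMI. -/
def lmi (R : Matrix (Fin n) (Fin n) ℝ) (ρ α γ : ℝ) (δ : Fin N → ℝ)
    (Q : Fin N → Matrix (Fin n) (Fin n) ℝ) (τ θ : Fin N → ℝ)
    (X : Fin N → Matrix (Fin n) (Fin n) ℝ) (i : Fin N) :
    Matrix ((Fin n ⊕ net.MidIdx i) ⊕ Fin n) ((Fin n ⊕ net.MidIdx i) ⊕ Fin n) ℝ :=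
  Matrix.fromBlocks
    (Matrix.fromBlocks
      (net.lmiS ρ γ δ Q X i + τ i • R + (θ i * α ^ 2) • (1 : Matrix (Fin n) (Fin n) ℝ))
      (net.lmiT γ X i)
      (net.lmiT γ X i)ᵀ
      (-net.lmiUpsilon γ δ τ X i))
    (Matrix.fromCols (X i) 0)ᵀ
    (Matrix.fromCols (X i) 0)
    (-(θ i • (1 : Matrix (Fin n) (Fin n) ℝ)))

/-- The triples `(τ_i, θ_i, X_i)`, `i = 1, …, N`, with `τ_i > 0`, `θ_i > 0`, `X_i = X_i' > 0`,
are feasible for the coupled LMIs. -/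
def Feasible (R : Matrix (Fin n) (Fin n) ℝ) (ρ α γ : ℝ) (δ : Fin N → ℝ)
    (Q : Fin N → Matrix (Fin n) (Fin n) ℝ) (τ θ : Fin N → ℝ)
    (X : Fin N → Matrix (Fin n) (Fin n) ℝ) : Prop :=
  ∀ i, 0 < τ i ∧ 0 < θ i ∧ (X i).PosDef ∧ (-net.lmi R ρ α γ δ Q τ θ X i).PosDef

/-- The interconnection gains `K_ij = γ² X_i⁻¹ H_ij' F_ij⁻¹`. -/
def gainK (γ : ℝ) (X : Fin N → Matrix (Fin n) (Fin n) ℝ) (i j : Fin N) :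
    Matrix (Fin n) (Fin (h i j)) ℝ :=
  γ ^ 2 • ((X i)⁻¹ * (net.H i j)ᵀ * (net.F i j)⁻¹)

/-- The observer gains `L_i = (γ² X_i⁻¹ C_2i' - B_2i D_2i') E_2i⁻¹`. -/
def gainL (γ : ℝ) (X : Fin N → Matrix (Fin n) (Fin n) ℝ) (i : Fin N) :
    Matrix (Fin n) (Fin (m i)) ℝ :=
  (γ ^ 2 • ((X i)⁻¹ * (net.C₂ i)ᵀ) - net.B₂ i * (net.D₂ i)ᵀ) * (net.E₂ i)⁻¹

/-! ### The closed-loop network with the parameter frozen at `ρ` -/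

/-- The measurement `y_i = C_2i x + D_2i w_i` of the leader received by agent `i`. -/
def meas (i : Fin N) (x : Vec n) (w : Vec (r i)) : Vec (m i) :=
  act (net.C₂ i) x + act (net.D₂ i) w

/-- The message `v_ij = H_ij x_j + G_ij w_ij` received by agent `i` from agent `j`. -/
def msg (i j : Fin N) (xj : Vec n) (w : Vec (s i j)) : Vec (h i j) :=
  act (net.H i j) xj + act (net.G i j) w

/-- The protocol `u_i = L_i (y_i - C_2i x_i) + ∑_{j ∈ V_i} K_ij (v_ij - H_ij x_i)`. -/
def control (K : ∀ i j, Matrix (Fin n) (Fin (h i j)) ℝ) (L : ∀ i, Matrix (Fin n) (Fin (m i)) ℝ)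
    (i : Fin N) (x : Vec n) (xs : Fin N → Vec n) (w : Vec (r i))
    (wc : ∀ j, Vec (s i j)) : Vec n :=
  act (L i) (net.meas i x w - act (net.C₂ i) (xs i))
    + ∑ j ∈ net.nbr i, act (K i j) (net.msg i j (xs j) (wc j) - act (net.H i j) (xs i))

/-- Right-hand side of the leader equation. -/
def leaderRHS (ρ : ℝ) (ψ : ℝ → Vec n → Vec n) (w₀ : ℝ → Vec r₀) (x : ℝ → Vec n) (t : ℝ) :
    Vec n :=
  act (net.A ρ) (x t) + act net.B₁ (net.φ (x t)) + act net.B₂₀ (w₀ t) + ψ t (x t)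

/-- Right-hand side of the equation of agent `i`. -/
def agentRHS (ρ : ℝ) (K : ∀ i j, Matrix (Fin n) (Fin (h i j)) ℝ)
    (L : ∀ i, Matrix (Fin n) (Fin (m i)) ℝ) (ψ : ℝ → Vec n → Vec n)
    (w : ∀ i, ℝ → Vec (r i)) (wc : ∀ i j, ℝ → Vec (s i j))
    (x : ℝ → Vec n) (xs : Fin N → ℝ → Vec n) (i : Fin N) (t : ℝ) : Vec n :=
  act (net.A ρ) (xs i t) + act net.B₁ (net.φ (xs i t)) + ψ t (xs i t)
    + net.control K L i (x t) (fun j => xs j t) (w i t) (fun j => wc i j t)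
    + act (net.B₂ i) (w i t)

/-- `x` (leader) and `xs i` (agents) form a Carathéodory solution on `[0, ∞)` of the closed-loop
network: each is the integral of a locally integrable right-hand side, i.e. it is locally
absolutely continuous and satisfies its differential equation almost everywhere. The initial
values are `x 0` and `xs i 0`. -/
structure IsSolution (ρ : ℝ) (K : ∀ i j, Matrix (Fin n) (Fin (h i j)) ℝ)
    (L : ∀ i, Matrix (Fin n) (Fin (m i)) ℝ) (ψ : ℝ → Vec n → Vec n)
    (w₀ : ℝ → Vec r₀) (w : ∀ i, ℝ → Vec (r i)) (wc : ∀ i j, ℝ → Vec (s i j))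
    (x : ℝ → Vec n) (xs : Fin N → ℝ → Vec n) : Prop where
  leader_int : ∀ t, 0 ≤ t → IntervalIntegrable (net.leaderRHS ρ ψ w₀ x) volume 0 t
  leader_eq : ∀ t, 0 ≤ t → x t = x 0 + ∫ u in (0 : ℝ)..t, net.leaderRHS ρ ψ w₀ x u
  agent_int : ∀ i t, 0 ≤ t →
    IntervalIntegrable (net.agentRHS ρ K L ψ w wc x xs i) volume 0 t
  agent_eq : ∀ i t, 0 ≤ t →
    xs i t = xs i 0 + ∫ u in (0 : ℝ)..t, net.agentRHS ρ K L ψ w wc x xs i u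

end Network

/-- `f ∈ L_2[0, ∞)`. -/
def IsL2 {k : ℕ} (f : ℝ → Vec k) : Prop := MemLp f 2 (volume.restrict (Ici (0 : ℝ)))

/-- `‖f‖_2² = ∫_0^∞ ‖f(t)‖² dt`. -/
def l2sq {k : ℕ} (f : ℝ → Vec k) : ℝ := ∫ t in Ici (0 : ℝ), ‖f t‖ ^ 2

/-- All the disturbances `w_0`, `w_i`, `w_ij` belong to `L_2[0, ∞)`. -/
def DistL2 (w₀ : ℝ → Vec r₀) (w : ∀ i, ℝ → Vec (r i)) (wc : ∀ i j, ℝ → Vec (s i j)) : Prop :=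
  IsL2 w₀ ∧ (∀ i, IsL2 (w i)) ∧ ∀ i j, IsL2 (wc i j)

/-- `‖(𝐱_0, w_0, 𝐰, 𝐰̄)‖²`, where `e0 i = x_0 - x_{i0}`. -/
def dataNormSq (P : Matrix (Fin n × Fin N) (Fin n × Fin N) ℝ) (e0 : Fin N → Vec n)
    (w₀ : ℝ → Vec r₀) (w : ∀ i, ℝ → Vec (r i)) (wc : ∀ i j, ℝ → Vec (s i j)) : ℝ :=
  quad P (stack e0) + l2sq w₀ + 1 / (N : ℝ) * ∑ i, (l2sq (w i) + ∑ j, l2sq (wc i j))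

/-- The uniform norm bound `‖ψ(t, a) - ψ(t, b)‖² ≤ α² ‖a - b‖²` on the mismatch. -/
def MismatchBound (α : ℝ) (ψ : ℝ → Vec n → Vec n) : Prop :=
  ∀ t, 0 ≤ t → ∀ a b, ‖ψ t a - ψ t b‖ ^ 2 ≤ α ^ 2 * ‖a - b‖ ^ 2

/-- The protocol with gains `K`, `L` solves the strong robust synchronization problem for the
network with the parameter frozen at `ρ`, with weights `Q_i`, `H_∞` level `γ` and matrix `P`,
for all mismatches `ψ` of norm bound `α` (in particular for `ψ = 0`). -/
structure StrongSync (net : Network N n l r₀ r m s h) (ρ α γ : ℝ)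
    (Q : Fin N → Matrix (Fin n) (Fin n) ℝ)
    (K : ∀ i j, Matrix (Fin n) (Fin (h i j)) ℝ) (L : ∀ i, Matrix (Fin n) (Fin (m i)) ℝ)
    (P : Matrix (Fin n × Fin N) (Fin n × Fin N) ℝ) : Prop where
  /-- the weight on the initial synchronization errors is symmetric positive definite -/
  posDef : P.PosDef
  /-- (i) without disturbances the synchronization errors are exponentially stable -/
  exp_stable : ∃ c > 0, ∃ ω > 0, ∀ ψ, MismatchBound α ψ →
    ∀ (x : ℝ → Vec n) (xs : Fin N → ℝ → Vec n),
      net.IsSolution ρ K L ψ (fun _ => 0) (fun _ _ => 0) (fun _ _ _ => 0) x xs →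
      ∀ i t, 0 ≤ t →
        ‖xs i t - x t‖ ^ 2 ≤ c * (∑ k, ‖xs k 0 - x 0‖ ^ 2) * Real.exp (-ω * t)
  /-- (ii) the running cost is integrable on `[0, ∞)` -/
  cost_integrable : ∀ ψ, MismatchBound α ψ →
    ∀ (w₀ : ℝ → Vec r₀) (w : ∀ i, ℝ → Vec (r i)) (wc : ∀ i j, ℝ → Vec (s i j)),
      DistL2 w₀ w wc → ∀ (x : ℝ → Vec n) (xs : Fin N → ℝ → Vec n),
      net.IsSolution ρ K L ψ w₀ w wc x xs →
      IntegrableOn (fun t => 1 / (N : ℝ) * quad (Matrix.blockDiagonal Q) (stack fun i => x t - xs i t)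
        + net.disagreement fun i => x t - xs i t) (Ici 0)
  /-- (ii) the supremum of the cost ratio over all data of nonzero norm is at most `γ²` -/
  cost_le : ∀ ψ, MismatchBound α ψ →
    ∀ (w₀ : ℝ → Vec r₀) (w : ∀ i, ℝ → Vec (r i)) (wc : ∀ i j, ℝ → Vec (s i j)),
      DistL2 w₀ w wc → ∀ (x : ℝ → Vec n) (xs : Fin N → ℝ → Vec n),
      net.IsSolution ρ K L ψ w₀ w wc x xs →
      dataNormSq P (fun i => x 0 - xs i 0) w₀ w wc ≠ 0 →
      (∫ t in Ici (0 : ℝ),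
          (1 / (N : ℝ) * quad (Matrix.blockDiagonal Q) (stack fun i => x t - xs i t)
            + net.disagreement fun i => x t - xs i t))
        / dataNormSq P (fun i => x 0 - xs i 0) w₀ w wc ≤ γ ^ 2
  /-- (iii) all agents synchronize asymptotically to the leader -/
  tendsto : ∀ ψ, MismatchBound α ψ →
    ∀ (w₀ : ℝ → Vec r₀) (w : ∀ i, ℝ → Vec (r i)) (wc : ∀ i j, ℝ → Vec (s i j)),
      DistL2 w₀ w wc → ∀ (x : ℝ → Vec n) (xs : Fin N → ℝ → Vec n),
      net.IsSolution ρ K L ψ w₀ w wc x xs →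
      Tendsto (fun t => ∑ i, ‖x t - xs i t‖ ^ 2) atTop (𝓝 0)

end

end SyncNetwork

end

/-! ### Quadratic forms, noise squares and the LMI. -/

namespace SyncNetwork

variable {N n l r₀ : ℕ} {r m : Fin N → ℕ} {s h : Fin N → Fin N → ℕ}

/-! With `e_i = x - x_i`, the storage function is `V = ∑ e_i' X_i e_i`. The aim is a single
pointwise inequality `V' ≤ γ² d - c - ω V`. Here `d` is the squared disturbance (with weight `N` on
`w₀`), `c = e'Qe + N Ψ(e)` and `ω > 0`.

For one agent (`agent_dissipation`) the gains are such that `X_i` cancels its inverse. Completing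
squares in `w_i` and `w_ij` then uses up half of the negative terms in `C_2i' E_2i⁻¹ C_2i` and
`H_ij' F_ij⁻¹ H_ij`, and the other half is the one in `S_i`. What is left is the quadratic form of
the LMI, in which the errors `e_j` of the neighbours act as additional inputs. The multipliers `τ_i`
and `θ_i` absorb the quadratic constraints on the increments of `φ` and `ψ`.

For the network (`network_dissipation`) the agent inequalities are added. Agent `j` is an input of
`q_j` others, each time at the price `2δ_j/(q_j+1) e_j' X_j e_j`, while its own LMI supplies `2δ_j
e_j' X_j e_j`. The difference, one share out of `q_j + 1`, is the decay term. The terms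
`(p_i+q_i)‖e_i‖²` and the cross products `e_i'e_j` add up to `N Ψ(e)`.

The conclusions follow by comparison: an integrating factor gives (i), integration with `V ≥ 0`
gives (ii), and integrability of `V` together with the vanishing tails of `∫ d` gives (iii). Passing
from `V(0)` to the weight `P = diag[κ X_i]` only needs `γ² κ N ≥ 1`. -/

lemma norm_sq_eq_dotProduct {k : ℕ} (v : Vec k) : ‖v‖ ^ 2 = v.ofLp ⬝ᵥ v.ofLp := by
  rw [EuclideanSpace.real_norm_sq_eq]
  simp [dotProduct, sq]

lemma dotProduct_self_nonneg {ι : Type*} [Fintype ι] (v : ι → ℝ) : 0 ≤ v ⬝ᵥ v := by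
  simpa using dotProduct_star_self_nonneg v

/-- A symmetric matrix can be moved across the dot product. -/
lemma dotProduct_mulVec_symm {ι : Type*} [Fintype ι] {M : Matrix ι ι ℝ} (hM : M.IsHermitian)
    (u v : ι → ℝ) : u ⬝ᵥ M *ᵥ v = v ⬝ᵥ M *ᵥ u := by
  have hM' : Mᵀ = M := by simpa using hM.eq
  rw [Matrix.dotProduct_mulVec, ← Matrix.mulVec_transpose, hM', dotProduct_comm]

lemma dotProduct_transpose_mulVec {ι κ : Type*} [Fintype ι] [Fintype κ] (M : Matrix ι κ ℝ)
    (u : κ → ℝ) (v : ι → ℝ) : u ⬝ᵥ Mᵀ *ᵥ v = M *ᵥ u ⬝ᵥ v := by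
  rw [Matrix.dotProduct_transpose_mulVec, dotProduct_comm]

lemma dotProduct_fromBlocks_diag {ι κ : Type*} [Fintype ι] [Fintype κ] (A : Matrix ι ι ℝ)
    (D : Matrix κ κ ℝ) (u : ι → ℝ) (v : κ → ℝ) :
    Sum.elim u v ⬝ᵥ Matrix.fromBlocks A 0 0 D *ᵥ Sum.elim u v = u ⬝ᵥ A *ᵥ u + v ⬝ᵥ D *ᵥ v := by
  simp [Matrix.fromBlocks_mulVec]

lemma dotProduct_fromBlocks_symm {ι κ : Type*} [Fintype ι] [Fintype κ] (A : Matrix ι ι ℝ)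
    (B : Matrix ι κ ℝ) (D : Matrix κ κ ℝ) (u : ι → ℝ) (v : κ → ℝ) :
    Sum.elim u v ⬝ᵥ Matrix.fromBlocks A B Bᵀ D *ᵥ Sum.elim u v
      = u ⬝ᵥ A *ᵥ u + 2 * (u ⬝ᵥ B *ᵥ v) + v ⬝ᵥ D *ᵥ v := by
  simp only [Matrix.fromBlocks_mulVec, Sum.elim_comp_inl, Sum.elim_comp_inr,
    sumElim_dotProduct_sumElim, dotProduct_add, Matrix.dotProduct_transpose_mulVec]
  ring

lemma dotProduct_fromBlocks_symm_lower {ι κ : Type*} [Fintype ι] [Fintype κ] (A : Matrix ι ι ℝ)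
    (B : Matrix κ ι ℝ) (D : Matrix κ κ ℝ) (u : ι → ℝ) (v : κ → ℝ) :
    Sum.elim u v ⬝ᵥ Matrix.fromBlocks A Bᵀ B D *ᵥ Sum.elim u v
      = u ⬝ᵥ A *ᵥ u + 2 * (v ⬝ᵥ B *ᵥ u) + v ⬝ᵥ D *ᵥ v := by
  simp only [Matrix.fromBlocks_mulVec, Sum.elim_comp_inl, Sum.elim_comp_inr,
    sumElim_dotProduct_sumElim, dotProduct_add, Matrix.dotProduct_transpose_mulVec]
  ring

section Noise

variable {ι κ : Type*} [Fintype ι] [DecidableEq ι] [Fintype κ]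

/-- Completing the square for a channel noise with covariance `G * Gᵀ`. -/
lemma noise_le {G : Matrix ι κ ℝ} (hG : (G * Gᵀ).PosDef) (a : ι → ℝ) (w : κ → ℝ) :
    -(2 * (a ⬝ᵥ (G * Gᵀ)⁻¹ *ᵥ G *ᵥ w)) ≤ a ⬝ᵥ (G * Gᵀ)⁻¹ *ᵥ a + w ⬝ᵥ w := by
  set M := (G * Gᵀ)⁻¹ with hM
  have hu : IsUnit (G * Gᵀ).det := hG.isUnit.map Matrix.detMonoidHom
  -- `Gᵀ M` is a right inverse of `G`, so the square of the shift `Gᵀ M a` is exactly `a' M a`.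
  have h0 := dotProduct_self_nonneg (w + Gᵀ *ᵥ M *ᵥ a)
  have h1 : w ⬝ᵥ Gᵀ *ᵥ M *ᵥ a = a ⬝ᵥ M *ᵥ G *ᵥ w := by
    rw [dotProduct_transpose_mulVec, dotProduct_mulVec_symm hG.inv.isHermitian]
  have h2 : Gᵀ *ᵥ M *ᵥ a ⬝ᵥ Gᵀ *ᵥ M *ᵥ a = a ⬝ᵥ M *ᵥ a := by
    rw [dotProduct_transpose_mulVec, Matrix.mulVec_mulVec, Matrix.mulVec_mulVec, hM,
      Matrix.mul_nonsing_inv _ hu, Matrix.one_mulVec, dotProduct_comm]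
  rw [add_dotProduct, dotProduct_add, dotProduct_add, dotProduct_comm (Gᵀ *ᵥ M *ᵥ a) w, h1, h2]
    at h0
  linarith

/-- Completing the square for a measurement noise, of which the component orthogonal to the
row space of `D` is kept. -/
lemma noise_add_orthogonal_le [DecidableEq κ] {D : Matrix ι κ ℝ} (hD : (D * Dᵀ).PosDef)
    (a : ι → ℝ) (w : κ → ℝ) :
    -(2 * (a ⬝ᵥ (D * Dᵀ)⁻¹ *ᵥ D *ᵥ w))
        + (w - Dᵀ *ᵥ (D * Dᵀ)⁻¹ *ᵥ D *ᵥ w) ⬝ᵥ (w - Dᵀ *ᵥ (D * Dᵀ)⁻¹ *ᵥ D *ᵥ w)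
      ≤ a ⬝ᵥ (D * Dᵀ)⁻¹ *ᵥ a + w ⬝ᵥ w := by
  have hu : IsUnit (D * Dᵀ).det := hD.isUnit.map Matrix.detMonoidHom
  -- `D` sees only the orthogonal projection of `w` onto its row space. Applying the bound to that
  -- projection leaves the square of the complement free, by Pythagoras.
  have h0 := noise_le hD a (Dᵀ *ᵥ (D * Dᵀ)⁻¹ *ᵥ D *ᵥ w)
  set M := (D * Dᵀ)⁻¹ with hM
  have h1 : D *ᵥ Dᵀ *ᵥ M *ᵥ D *ᵥ w = D *ᵥ w := by
    rw [Matrix.mulVec_mulVec, Matrix.mulVec_mulVec, hM, Matrix.mul_nonsing_inv _ hu,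
      Matrix.one_mulVec]
  have h2 : w ⬝ᵥ Dᵀ *ᵥ M *ᵥ D *ᵥ w = D *ᵥ w ⬝ᵥ M *ᵥ D *ᵥ w := dotProduct_transpose_mulVec _ _ _
  have h3 : Dᵀ *ᵥ M *ᵥ D *ᵥ w ⬝ᵥ Dᵀ *ᵥ M *ᵥ D *ᵥ w = D *ᵥ w ⬝ᵥ M *ᵥ D *ᵥ w := by
    rw [dotProduct_transpose_mulVec, h1]
  rw [h1, h3] at h0
  rw [sub_dotProduct, dotProduct_sub, dotProduct_sub, h3,
    dotProduct_comm (Dᵀ *ᵥ M *ᵥ D *ᵥ w) w, h2]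
  linarith

end Noise

lemma blockDiagonal_dotProduct {ι κ : Type*} [Fintype ι] [Fintype κ] [DecidableEq κ]
    (M : κ → Matrix ι ι ℝ) (g : κ → ι → ℝ) :
    (fun b : ι × κ => g b.2 b.1) ⬝ᵥ Matrix.blockDiagonal M *ᵥ (fun b : ι × κ => g b.2 b.1)
      = ∑ k, g k ⬝ᵥ M k *ᵥ g k := by
  simp only [dotProduct, Matrix.mulVec, Matrix.blockDiagonal_apply, Fintype.sum_prod_type,
    ite_mul, zero_mul, Finset.sum_ite_eq, Finset.mem_univ, if_true]
  rw [Finset.sum_comm]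

namespace Network

variable (net : Network N n l r₀ r m s h)

/-- The LMI as an inequality between quadratic forms. -/
lemma lmi_quad_le {R : Matrix (Fin n) (Fin n) ℝ} {ρ α γ : ℝ} {δ : Fin N → ℝ}
    {Q : Fin N → Matrix (Fin n) (Fin n) ℝ} {τ θ : Fin N → ℝ}
    {X : Fin N → Matrix (Fin n) (Fin n) ℝ} {i : Fin N} (hX : (X i).IsHermitian)
    (hlmi : (-net.lmi R ρ α γ δ Q τ θ X i).PosDef)
    (e : Fin n → ℝ) (w₀ : Fin r₀ → ℝ) (w : Fin (r i) → ℝ) (p : Fin l → ℝ)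
    (g : Fin N → Fin n → ℝ) (d : Fin n → ℝ) :
    e ⬝ᵥ net.lmiS ρ γ δ Q X i *ᵥ e + τ i * (e ⬝ᵥ R *ᵥ e) + θ i * α ^ 2 * (e ⬝ᵥ e)
      + 2 * (e ⬝ᵥ X i *ᵥ net.B₂₀ *ᵥ w₀
        + e ⬝ᵥ X i *ᵥ net.B₂ i *ᵥ (w - (net.D₂ i)ᵀ *ᵥ (net.E₂ i)⁻¹ *ᵥ net.D₂ i *ᵥ w)
        + e ⬝ᵥ X i *ᵥ net.B₁ *ᵥ p
        + ∑ j ∈ net.nbr i, (γ ^ 2 * (e ⬝ᵥ (net.H i j)ᵀ *ᵥ (net.F i j)⁻¹ *ᵥ net.H i j *ᵥ g j)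
            - e ⬝ᵥ g j)
        + e ⬝ᵥ X i *ᵥ d)
      ≤ γ ^ 2 * (w₀ ⬝ᵥ w₀) + γ ^ 2 * (w ⬝ᵥ w) + τ i * (p ⬝ᵥ p)
        + ∑ j ∈ net.nbr i, 2 * δ j / ((net.outDeg j : ℝ) + 1) * (g j ⬝ᵥ X j *ᵥ g j)
        + θ i * (d ⬝ᵥ d) := by
  have hZ := blockDiagonal_dotProduct
    (fun j : {j // j ∈ net.nbr i} => (2 * δ j / ((net.outDeg j : ℝ) + 1)) • X j) (fun j => g j)
  have hXi : net.lmiXi γ i *ᵥ (fun b => g b.2 b.1) = ∑ j ∈ net.nbr i,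
      (γ ^ 2 • (net.H i j)ᵀ *ᵥ (net.F i j)⁻¹ *ᵥ net.H i j *ᵥ g j - g j) := by
    rw [← Finset.sum_coe_sort]
    ext a
    have (j : Fin N) : γ ^ 2 • (net.H i j)ᵀ *ᵥ (net.F i j)⁻¹ *ᵥ net.H i j *ᵥ g j - g j
        = (γ ^ 2 • ((net.H i j)ᵀ * (net.F i j)⁻¹ * net.H i j) - 1) *ᵥ g j := by
      rw [Matrix.sub_mulVec, Matrix.smul_mulVec, Matrix.one_mulVec, Matrix.mulVec_mulVec,
        Matrix.mulVec_mulVec, Matrix.mul_assoc]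
    simp only [this, Finset.sum_apply]
    simp only [Matrix.mulVec, dotProduct, lmiXi, Matrix.of_apply, Fintype.sum_prod_type]
    rw [Finset.sum_comm]
  -- The test vector follows the block order of the LMI; `g j` fills the column of `Ξ_i` belonging
  -- to `j ∈ V_i`, and `d` pairs with the last block `X_i`.
  have h0 := hlmi.posSemidef.dotProduct_mulVec_nonneg
    (Sum.elim (Sum.elim e (Sum.elim w₀ (Sum.elim w (Sum.elim p fun b => g b.2 b.1)))) d)
  rw [lmi, star_trivial, Matrix.neg_mulVec, dotProduct_neg, dotProduct_fromBlocks_symm_lower,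
    dotProduct_fromBlocks_symm, lmiT, Matrix.fromCols_mulVec_sumElim,
    Matrix.fromCols_mulVec_sumElim, Matrix.fromCols_mulVec_sumElim, hXi, Matrix.neg_mulVec,
    lmiUpsilon, dotProduct_neg,
    dotProduct_fromBlocks_diag, dotProduct_fromBlocks_diag, dotProduct_fromBlocks_diag, lmiZ, hZ,
    Matrix.fromCols_mulVec_sumElim, dotProduct_add d, dotProduct_mulVec_symm hX d e,
    Finset.sum_coe_sort (net.nbr i)
      (fun k => g k ⬝ᵥ ((2 * δ k / ((net.outDeg k : ℝ) + 1)) • X k) *ᵥ g k)] at h0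
  simp only [Matrix.add_mulVec, Matrix.smul_mulVec, Matrix.one_mulVec, Matrix.neg_mulVec,
    dotProduct_add, dotProduct_smul, dotProduct_neg, smul_eq_mul, ← Matrix.mulVec_mulVec,
    Matrix.sub_mulVec, Matrix.zero_mulVec, dotProduct_zero, dotProduct_sum, dotProduct_sub] at h0
  simp only [Matrix.mulVec_sub, dotProduct_sub] at h0 ⊢
  linarith

end Network

end SyncNetwork

/-! ### Pointwise dissipation inequalities. -/

namespace SyncNetwork

variable {N n l r₀ : ℕ} {r m : Fin N → ℕ} {s h : Fin N → Fin N → ℕ}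

namespace Network

variable (net : Network N n l r₀ r m s h)

/-- The factor `X_i⁻¹` in the gain cancels the weight `X_i` of the storage function, so the coupling
enters through `H_ij' F_ij⁻¹` alone. -/
lemma dotProduct_gainK {γ : ℝ} {X : Fin N → Matrix (Fin n) (Fin n) ℝ} {i : Fin N}
    (hX : (X i).PosDef) (j : Fin N) (e : Fin n → ℝ) (v : Fin (h i j) → ℝ) :
    e ⬝ᵥ X i *ᵥ net.gainK γ X i j *ᵥ v
      = γ ^ 2 * (net.H i j *ᵥ e ⬝ᵥ (net.F i j)⁻¹ *ᵥ v) := by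
  have hu : IsUnit (X i).det := hX.isUnit.map Matrix.detMonoidHom
  rw [gainK, Matrix.smul_mulVec, Matrix.mulVec_smul, dotProduct_smul, smul_eq_mul,
    Matrix.mul_assoc, ← Matrix.mulVec_mulVec, Matrix.mulVec_mulVec _ (X i),
    Matrix.mul_nonsing_inv _ hu, Matrix.one_mulVec, ← Matrix.mulVec_mulVec,
    dotProduct_transpose_mulVec]

lemma dotProduct_gainL {γ : ℝ} {X : Fin N → Matrix (Fin n) (Fin n) ℝ} {i : Fin N}
    (hX : (X i).PosDef) (e : Fin n → ℝ) (v : Fin (m i) → ℝ) :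
    e ⬝ᵥ X i *ᵥ net.gainL γ X i *ᵥ v
      = γ ^ 2 * (net.C₂ i *ᵥ e ⬝ᵥ (net.E₂ i)⁻¹ *ᵥ v)
        - e ⬝ᵥ X i *ᵥ net.B₂ i *ᵥ (net.D₂ i)ᵀ *ᵥ (net.E₂ i)⁻¹ *ᵥ v := by
  have hu : IsUnit (X i).det := hX.isUnit.map Matrix.detMonoidHom
  rw [gainL, ← Matrix.mulVec_mulVec, Matrix.sub_mulVec, Matrix.smul_mulVec, Matrix.mulVec_sub,
    Matrix.mulVec_smul, dotProduct_sub, dotProduct_smul, smul_eq_mul,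
    ← Matrix.mulVec_mulVec, Matrix.mulVec_mulVec _ (X i),
    Matrix.mul_nonsing_inv _ hu, Matrix.one_mulVec, ← Matrix.mulVec_mulVec,
    dotProduct_transpose_mulVec]

lemma lmiS_quad {ρ γ : ℝ} {δ : Fin N → ℝ} {Q X : Fin N → Matrix (Fin n) (Fin n) ℝ} {i : Fin N}
    (hX : (X i).IsHermitian) (e : Fin n → ℝ) :
    e ⬝ᵥ net.lmiS ρ γ δ Q X i *ᵥ e
      = 2 * (e ⬝ᵥ X i *ᵥ net.A ρ *ᵥ e) + 2 * δ i * (e ⬝ᵥ X i *ᵥ e)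
        + 2 * (e ⬝ᵥ X i *ᵥ net.B₂ i *ᵥ (net.D₂ i)ᵀ *ᵥ (net.E₂ i)⁻¹ *ᵥ net.C₂ i *ᵥ e)
        + ((net.inDeg i : ℝ) + net.outDeg i) * (e ⬝ᵥ e)
        - γ ^ 2 * (net.C₂ i *ᵥ e ⬝ᵥ (net.E₂ i)⁻¹ *ᵥ net.C₂ i *ᵥ e)
        - γ ^ 2 * ∑ j ∈ net.nbr i, net.H i j *ᵥ e ⬝ᵥ (net.F i j)⁻¹ *ᵥ net.H i j *ᵥ e
        + e ⬝ᵥ Q i *ᵥ e := by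
  have htr (M : Matrix (Fin n) (Fin n) ℝ) : e ⬝ᵥ (Mᵀ * X i) *ᵥ e = e ⬝ᵥ (X i * M) *ᵥ e := by
    rw [← Matrix.mulVec_mulVec, ← Matrix.mulVec_mulVec, dotProduct_transpose_mulVec,
      dotProduct_mulVec_symm hX]
  rw [lmiS, Matrix.add_mulVec, Matrix.sub_mulVec, Matrix.sub_mulVec, Matrix.add_mulVec,
    Matrix.add_mulVec, dotProduct_add, dotProduct_sub, dotProduct_sub, dotProduct_add,
    dotProduct_add, htr]
  simp only [Matrix.mul_add, Matrix.add_mulVec, Matrix.smul_mulVec, Matrix.one_mulVec,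
    dotProduct_add, dotProduct_smul, smul_eq_mul, ← Matrix.mulVec_mulVec, Matrix.sum_mulVec,
    dotProduct_sum, dotProduct_transpose_mulVec, Matrix.mul_smul, Matrix.mul_one]
  ring

/-- The dissipation inequality for one agent; `e k` is the synchronization error of agent `k`. -/
lemma agent_dissipation {R : Matrix (Fin n) (Fin n) ℝ} {ρ α γ : ℝ} {δ : Fin N → ℝ}
    {Q : Fin N → Matrix (Fin n) (Fin n) ℝ} {τ θ : Fin N → ℝ}
    {X : Fin N → Matrix (Fin n) (Fin n) ℝ} {i : Fin N}
    (hE : (net.E₂ i).PosDef) (hF : ∀ j ∈ net.nbr i, (net.F i j).PosDef)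
    (hτ : 0 < τ i) (hθ : 0 < θ i) (hX : (X i).PosDef)
    (hlmi : (-net.lmi R ρ α γ δ Q τ θ X i).PosDef)
    (e : Fin N → Fin n → ℝ) {p : Fin l → ℝ} {d : Fin n → ℝ}
    (hp : p ⬝ᵥ p ≤ e i ⬝ᵥ R *ᵥ e i) (hd : d ⬝ᵥ d ≤ α ^ 2 * (e i ⬝ᵥ e i))
    (w₀ : Fin r₀ → ℝ) (w : Fin (r i) → ℝ) (wc : ∀ j, Fin (s i j) → ℝ) :
    2 * (e i ⬝ᵥ X i *ᵥ (net.A ρ *ᵥ e i + net.B₁ *ᵥ p + net.B₂₀ *ᵥ w₀ + d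
        - net.gainL γ X i *ᵥ (net.C₂ i *ᵥ e i + net.D₂ i *ᵥ w)
        - ∑ j ∈ net.nbr i, net.gainK γ X i j *ᵥ (net.H i j *ᵥ (e i - e j) + net.G i j *ᵥ wc j)
        - net.B₂ i *ᵥ w))
      ≤ γ ^ 2 * (w₀ ⬝ᵥ w₀ + w ⬝ᵥ w + ∑ j ∈ net.nbr i, wc j ⬝ᵥ wc j)
        + ∑ j ∈ net.nbr i, 2 * δ j / ((net.outDeg j : ℝ) + 1) * (e j ⬝ᵥ X j *ᵥ e j)
        - 2 * δ i * (e i ⬝ᵥ X i *ᵥ e i)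
        - ((net.inDeg i : ℝ) + net.outDeg i) * (e i ⬝ᵥ e i) - e i ⬝ᵥ Q i *ᵥ e i
        + 2 * ∑ j ∈ net.nbr i, e i ⬝ᵥ e j := by
  -- In `-L_i D_2i w - B_2i w` the part of `B_2i w` along the row space of `D_2i` cancels. Only
  -- `-B_2i` times the complementary component of `w` remains, hence the choice of this component,
  -- with a minus sign, as disturbance in the LMI. Its square on the right is paid for by the
  -- orthogonal term kept in `noise_add_orthogonal_le`.
  have hl := net.lmi_quad_le hX.isHermitian hlmi (e i) w₀
    (-(w - (net.D₂ i)ᵀ *ᵥ (net.E₂ i)⁻¹ *ᵥ net.D₂ i *ᵥ w)) p e d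
  have hu : IsUnit (net.D₂ i * (net.D₂ i)ᵀ).det := hE.isUnit.map Matrix.detMonoidHom
  have hproj : net.D₂ i *ᵥ (w - (net.D₂ i)ᵀ *ᵥ (net.E₂ i)⁻¹ *ᵥ net.D₂ i *ᵥ w) = 0 := by
    rw [Matrix.mulVec_sub, Matrix.mulVec_mulVec, Matrix.mulVec_mulVec, E₂,
      Matrix.mul_nonsing_inv _ hu, Matrix.one_mulVec, sub_self]
  have hw := mul_le_mul_of_nonneg_left
    (noise_add_orthogonal_le (D := net.D₂ i) hE (net.C₂ i *ᵥ e i) w) (sq_nonneg γ)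
  have hwc := mul_le_mul_of_nonneg_left (Finset.sum_le_sum fun j hj =>
    noise_le (G := net.G i j) (hF j hj) (net.H i j *ᵥ e i) (wc j)) (sq_nonneg γ)
  have hp' := mul_le_mul_of_nonneg_left hp hτ.le
  have hd' := mul_le_mul_of_nonneg_left hd hθ.le
  rw [net.lmiS_quad hX.isHermitian, Matrix.mulVec_neg _ (net.D₂ i), hproj] at hl
  simp only [show ∀ i, net.D₂ i * (net.D₂ i)ᵀ = net.E₂ i from fun _ => rfl,
    show ∀ i j, net.G i j * (net.G i j)ᵀ = net.F i j from fun _ _ => rfl] at hw hwc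
  simp only [neg_dotProduct, dotProduct_neg, Matrix.mulVec_neg, Matrix.mulVec_zero, neg_zero,
    sub_zero, neg_neg, dotProduct_transpose_mulVec, Finset.sum_sub_distrib, ← Finset.mul_sum] at hl
  simp only [Matrix.mulVec_sub, Matrix.mulVec_add, Matrix.mulVec_sum, dotProduct_sub,
    dotProduct_add, dotProduct_sum, net.dotProduct_gainK hX, net.dotProduct_gainL hX,
    Finset.sum_add_distrib, Finset.sum_sub_distrib, ← Finset.mul_sum, Finset.sum_neg_distrib,
    mul_add, mul_sub] at hl hw hwc ⊢
  linarith

/-- Each neighbour sum over all agents counts agent `j` exactly `q_j` times. -/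
lemma sum_nbr_eq (f : Fin N → ℝ) :
    ∑ i, ∑ j ∈ net.nbr i, f j = ∑ j, (net.outDeg j : ℝ) * f j := by
  simp only [nbr, outDeg, Finset.sum_filter]
  rw [Finset.sum_comm]
  refine Finset.sum_congr rfl fun j _ => ?_
  rw [← Finset.sum_filter, Finset.sum_const, nsmul_eq_mul]

/-- Expanding the squares, `‖e_i‖²` occurs `p_i` times as the receiving end and `q_i` times as the
sending end of an edge. This is the origin of `(p_i + q_i) I` in `S_i` and of `-I` in `Ξ_i`. -/
lemma sum_nbr_sub_sq (e : Fin N → Fin n → ℝ) :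
    ∑ i, ∑ j ∈ net.nbr i, (e j - e i) ⬝ᵥ (e j - e i)
      = ∑ i, (((net.inDeg i : ℝ) + net.outDeg i) * (e i ⬝ᵥ e i)
          - 2 * ∑ j ∈ net.nbr i, e i ⬝ᵥ e j) := by
  have h1 (i j : Fin N) : (e j - e i) ⬝ᵥ (e j - e i)
      = e j ⬝ᵥ e j + (e i ⬝ᵥ e i - 2 * (e i ⬝ᵥ e j)) := by
    rw [sub_dotProduct, dotProduct_sub, dotProduct_sub, dotProduct_comm (e j) (e i)]
    ring
  simp only [h1, Finset.sum_add_distrib, net.sum_nbr_eq fun j => e j ⬝ᵥ e j]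
  rw [← Finset.sum_add_distrib]
  refine Finset.sum_congr rfl fun i _ => ?_
  rw [Finset.sum_sub_distrib, Finset.sum_const, nsmul_eq_mul, ← Finset.mul_sum, inDeg]
  ring

/-- The dissipation inequality for the network. -/
lemma network_dissipation {R : Matrix (Fin n) (Fin n) ℝ} {ρ α γ : ℝ} {δ : Fin N → ℝ}
    {Q : Fin N → Matrix (Fin n) (Fin n) ℝ} {τ θ : Fin N → ℝ}
    {X : Fin N → Matrix (Fin n) (Fin n) ℝ}
    (hE : ∀ i, (net.E₂ i).PosDef) (hF : ∀ i, ∀ j ∈ net.nbr i, (net.F i j).PosDef)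
    (hfeas : net.Feasible R ρ α γ δ Q τ θ X)
    (e : Fin N → Fin n → ℝ) {p : Fin N → Fin l → ℝ} {d : Fin N → Fin n → ℝ}
    (hp : ∀ i, p i ⬝ᵥ p i ≤ e i ⬝ᵥ R *ᵥ e i) (hd : ∀ i, d i ⬝ᵥ d i ≤ α ^ 2 * (e i ⬝ᵥ e i))
    (w₀ : Fin r₀ → ℝ) (w : ∀ i, Fin (r i) → ℝ) (wc : ∀ i j, Fin (s i j) → ℝ) :
    ∑ i, 2 * (e i ⬝ᵥ X i *ᵥ (net.A ρ *ᵥ e i + net.B₁ *ᵥ p i + net.B₂₀ *ᵥ w₀ + d i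
        - net.gainL γ X i *ᵥ (net.C₂ i *ᵥ e i + net.D₂ i *ᵥ w i)
        - ∑ j ∈ net.nbr i,
            net.gainK γ X i j *ᵥ (net.H i j *ᵥ (e i - e j) + net.G i j *ᵥ wc i j)
        - net.B₂ i *ᵥ w i))
      ≤ γ ^ 2 * (N * (w₀ ⬝ᵥ w₀) + ∑ i, (w i ⬝ᵥ w i + ∑ j, wc i j ⬝ᵥ wc i j))
        - (∑ i, e i ⬝ᵥ Q i *ᵥ e i + ∑ i, ∑ j ∈ net.nbr i, (e j - e i) ⬝ᵥ (e j - e i))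
        - ∑ i, 2 * δ i / ((net.outDeg i : ℝ) + 1) * (e i ⬝ᵥ X i *ᵥ e i) := by
  have hsum := Finset.sum_le_sum fun i (_ : i ∈ Finset.univ) =>
    net.agent_dissipation (hE i) (hF i) (hfeas i).1 (hfeas i).2.1 (hfeas i).2.2.1 (hfeas i).2.2.2
      e (hp i) (hd i) w₀ (w i) (wc i)
  refine hsum.trans ?_
  -- The data norm counts channel disturbances for all pairs, so the sum over neighbours is
  -- enlarged.
  have hwc : ∑ i, ∑ j ∈ net.nbr i, wc i j ⬝ᵥ wc i j ≤ ∑ i, ∑ j, wc i j ⬝ᵥ wc i j :=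
    Finset.sum_le_sum fun i _ => Finset.sum_le_sum_of_subset_of_nonneg (Finset.subset_univ _)
      fun j _ _ => dotProduct_self_nonneg _
  have hwc' := mul_le_mul_of_nonneg_left hwc (sq_nonneg γ)
  -- The `q_i + 1` equal shares of `2δ_i`: `q_i` of them cancel the `Z` terms of the agents that
  -- receive from `i`, and the last one survives as decay.
  have hδ : ∑ i, 2 * δ i * (e i ⬝ᵥ X i *ᵥ e i)
      = ∑ i, (net.outDeg i : ℝ) * (2 * δ i / ((net.outDeg i : ℝ) + 1) * (e i ⬝ᵥ X i *ᵥ e i))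
        + ∑ i, 2 * δ i / ((net.outDeg i : ℝ) + 1) * (e i ⬝ᵥ X i *ᵥ e i) := by
    rw [← Finset.sum_add_distrib]
    refine Finset.sum_congr rfl fun i _ => ?_
    have : (net.outDeg i : ℝ) + 1 ≠ 0 := by positivity
    field_simp
  rw [net.sum_nbr_sub_sq]
  simp only [Finset.sum_add_distrib, Finset.sum_sub_distrib, ← Finset.mul_sum,
    Finset.sum_const, Finset.card_univ, Fintype.card_fin, nsmul_eq_mul,
    net.sum_nbr_eq fun j => 2 * δ j / ((net.outDeg j : ℝ) + 1) * (e j ⬝ᵥ X j *ᵥ e j), hδ, mul_add]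
    at hwc' ⊢
  linarith

end Network

end SyncNetwork

/-! ### Calculus of Carathéodory primitives. -/

namespace SyncNetwork

/-- `x` is on `[0, ∞)` the primitive of the locally integrable function `f`. -/
structure IsPrimitive (f x : ℝ → ℝ) : Prop where
  intervalIntegrable : ∀ t, 0 ≤ t → IntervalIntegrable f volume 0 t
  eq_integral : ∀ t, 0 ≤ t → x t = x 0 + ∫ u in (0 : ℝ)..t, f u

namespace IsPrimitive

variable {f g x y : ℝ → ℝ}

lemma continuousOn_Icc (hx : IsPrimitive f x) {T : ℝ} (hT : 0 ≤ T) :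
    ContinuousOn x (Icc 0 T) := by
  have h := intervalIntegral.continuousOn_primitive_interval' (hx.intervalIntegrable T hT)
    (left_mem_uIcc)
  rw [uIcc_of_le hT] at h
  exact (continuousOn_const.add h).congr fun t ht => hx.eq_integral t ht.1

lemma continuousOn (hx : IsPrimitive f x) : ContinuousOn x (Ici 0) := by
  intro t ht
  have ht' : (0 : ℝ) ≤ t := ht
  refine ((hx.continuousOn_Icc (by linarith : (0 : ℝ) ≤ t + 1)) t
    ⟨ht, by linarith⟩).mono_of_mem_nhdsWithin ?_
  rw [← Ici_inter_Iic]
  exact inter_mem_nhdsWithin _ (Iic_mem_nhds (by linarith))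

/-- Integration by parts for absolutely continuous functions. It is run on the explicit primitives,
which agree with `x` and `y` on `[0, t]` and whose derivatives are `f` and `g` almost everywhere by
Lebesgue differentiation. -/
lemma mul (hx : IsPrimitive f x) (hy : IsPrimitive g y) :
    IsPrimitive (fun t => f t * y t + x t * g t) (fun t => x t * y t) where
  intervalIntegrable t ht := by
    refine ((hx.intervalIntegrable t ht).mul_continuousOn ?_).add
      ((hy.intervalIntegrable t ht).continuousOn_mul ?_)
    · rw [uIcc_of_le ht]; exact hy.continuousOn_Icc ht
    · rw [uIcc_of_le ht]; exact hx.continuousOn_Icc ht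
  eq_integral t ht := by
    have hac {k : ℝ → ℝ} (hk : IntervalIntegrable k volume 0 t) (c : ℝ) :
        AbsolutelyContinuousOnInterval (fun u => c + ∫ z in (0 : ℝ)..u, k z) 0 t :=
      ((LipschitzWith.const c).lipschitzOnWith.absolutelyContinuousOnInterval).add
        (hk.absolutelyContinuousOnInterval_intervalIntegral left_mem_uIcc)
    have hderiv {k : ℝ → ℝ} (hk : IntervalIntegrable k volume 0 t) (c : ℝ) :
        ∀ᵐ u, u ∈ uIcc 0 t → deriv (fun u => c + ∫ z in (0 : ℝ)..u, k z) u = k u := by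
      filter_upwards [hk.ae_hasDerivAt_integral] with u hu hmem
      exact ((hu hmem 0 left_mem_uIcc).const_add c).deriv
    have hfi := hx.intervalIntegrable t ht
    have hgi := hy.intervalIntegrable t ht
    have key := (hac hfi (x 0)).integral_deriv_mul_eq_sub (hac hgi (y 0))
    have hcongr : ∫ u in (0 : ℝ)..t, (f u * y u + x u * g u)
        = ∫ u in (0 : ℝ)..t, (deriv (fun u => x 0 + ∫ z in (0 : ℝ)..u, f z) u
            * (y 0 + ∫ z in (0 : ℝ)..u, g z)
          + (x 0 + ∫ z in (0 : ℝ)..u, f z) * deriv (fun u => y 0 + ∫ z in (0 : ℝ)..u, g z) u) := by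
      refine intervalIntegral.integral_congr_ae ?_
      filter_upwards [hderiv hfi (x 0), hderiv hgi (y 0)] with u h1 h2 hu
      have hu' := uIoc_subset_uIcc hu
      have hu0 : 0 ≤ u := by rw [uIcc_of_le ht] at hu'; exact hu'.1
      rw [h1 hu', h2 hu', ← hx.eq_integral u hu0, ← hy.eq_integral u hu0]
    rw [hcongr, key, ← hx.eq_integral t ht, ← hy.eq_integral t ht]
    simp

lemma sub (hx : IsPrimitive f x) (hy : IsPrimitive g y) :
    IsPrimitive (fun t => f t - g t) (fun t => x t - y t) where
  intervalIntegrable t ht := (hx.intervalIntegrable t ht).sub (hy.intervalIntegrable t ht)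
  eq_integral t ht := by
    rw [intervalIntegral.integral_sub (hx.intervalIntegrable t ht) (hy.intervalIntegrable t ht),
      hx.eq_integral t ht, hy.eq_integral t ht]
    ring

lemma const_mul (hx : IsPrimitive f x) (c : ℝ) :
    IsPrimitive (fun t => c * f t) (fun t => c * x t) where
  intervalIntegrable t ht := (hx.intervalIntegrable t ht).const_mul c
  eq_integral t ht := by
    rw [intervalIntegral.integral_const_mul, hx.eq_integral t ht]
    ring

lemma sum {ι : Type*} (S : Finset ι) {f x : ι → ℝ → ℝ} (hx : ∀ i ∈ S, IsPrimitive (f i) (x i)) :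
    IsPrimitive (fun t => ∑ i ∈ S, f i t) (fun t => ∑ i ∈ S, x i t) where
  intervalIntegrable t ht := by
    simpa [Finset.sum_fn] using
      IntervalIntegrable.sum S fun i hi => (hx i hi).intervalIntegrable t ht
  eq_integral t ht := by
    rw [intervalIntegral.integral_finsetSum fun i hi => (hx i hi).intervalIntegrable t ht,
      ← Finset.sum_add_distrib]
    exact Finset.sum_congr rfl fun i hi => (hx i hi).eq_integral t ht

lemma sub_eq_integral (hx : IsPrimitive f x) {a t : ℝ} (ha : 0 ≤ a) (hat : a ≤ t) :
    IntervalIntegrable f volume a t ∧ x t - x a = ∫ u in a..t, f u := by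
  have h1 := hx.intervalIntegrable a ha
  have h2 := hx.intervalIntegrable t (ha.trans hat)
  refine ⟨h1.symm.trans h2, ?_⟩
  rw [← intervalIntegral.integral_interval_sub_left h2 h1, hx.eq_integral t (ha.trans hat),
    hx.eq_integral a ha]
  ring

lemma sub_le_integral (hx : IsPrimitive f x) {a t : ℝ} (ha : 0 ≤ a) (hat : a ≤ t)
    (hg : IntervalIntegrable g volume a t) (hfg : ∀ u, 0 ≤ u → f u ≤ g u) :
    x t - x a ≤ ∫ u in a..t, g u := by
  obtain ⟨hi, he⟩ := hx.sub_eq_integral ha hat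
  rw [he]
  exact intervalIntegral.integral_mono_on hat hi hg fun u hu => hfg u (ha.trans hu.1)

lemma of_continuous_deriv (hx : ∀ t, HasDerivAt x (f t) t) (hf : Continuous f) :
    IsPrimitive f x where
  intervalIntegrable t _ := hf.intervalIntegrable 0 t
  eq_integral t _ := by
    rw [intervalIntegral.integral_eq_sub_of_hasDerivAt (fun u _ => hx u)
      (hf.intervalIntegrable 0 t)]
    ring

end IsPrimitive

lemma integrableOn_Ici_of_integral_le {c : ℝ → ℝ} {M : ℝ} (hc : ContinuousOn c (Ici 0))
    (hc0 : ∀ t, 0 ≤ t → 0 ≤ c t) (hM : ∀ T, 0 ≤ T → ∫ t in (0 : ℝ)..T, c t ≤ M) :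
    IntegrableOn c (Ici 0) ∧ ∫ t in Ici (0 : ℝ), c t ≤ M := by
  have hloc (T : ℝ) (hT : 0 ≤ T) : IntegrableOn c (Icc 0 T) :=
    (hc.mono Icc_subset_Ici_self).integrableOn_Icc
  have hint : IntegrableOn c (Ioi 0) := by
    refine integrableOn_Ioi_of_intervalIntegral_norm_bounded M 0 (b := id) (l := atTop)
      (fun T => ?_) tendsto_id ?_
    · rcases le_total 0 T with hT | hT
      · exact (hloc T hT).mono_set Ioc_subset_Icc_self
      · simp [Ioc_eq_empty_of_le hT]
    · filter_upwards [eventually_ge_atTop 0] with T hT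
      refine le_trans (le_of_eq ?_) (hM T hT)
      refine intervalIntegral.integral_congr fun t ht => ?_
      rw [id, uIcc_of_le hT] at ht
      exact Real.norm_of_nonneg (hc0 t ht.1)
  refine ⟨(integrableOn_Ici_iff_integrableOn_Ioi (by simp)).2 hint, ?_⟩
  rw [integral_Ici_eq_integral_Ioi]
  refine le_of_tendsto (intervalIntegral_tendsto_integral_Ioi 0 hint tendsto_id) ?_
  filter_upwards [eventually_ge_atTop 0] with T hT using hM T hT

/-! ### Comparison arguments for a storage function. -/

section Storage

variable {v V : ℝ → ℝ} {ω : ℝ}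

/-- Gronwall with integrating factor: `V(t) e^{ωt}` has nonpositive derivative. -/
lemma storage_exp_decay (hV : IsPrimitive v V) (hv : ∀ t, 0 ≤ t → v t ≤ -ω * V t) {t : ℝ}
    (ht : 0 ≤ t) : V t ≤ V 0 * Real.exp (-ω * t) := by
  have hexp : IsPrimitive (fun t => ω * Real.exp (ω * t)) fun t => Real.exp (ω * t) := by
    refine .of_continuous_deriv (fun t => ?_) (by fun_prop)
    simpa [mul_comm] using ((hasDerivAt_id t).const_mul ω).exp
  have h := (hV.mul hexp).sub_le_integral (g := fun _ => 0) le_rfl ht (by simp) fun u hu => by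
    have := mul_le_mul_of_nonneg_right (hv u hu) (Real.exp_pos (ω * u)).le
    linarith
  simp only [intervalIntegral.integral_zero, mul_zero, Real.exp_zero, mul_one] at h
  rw [neg_mul, Real.exp_neg, ← div_eq_mul_inv, le_div_iff₀ (Real.exp_pos _)]
  linarith

variable {c g : ℝ → ℝ}

/-- Integrate over `[0, T]` and drop `V(T) ≥ 0`; the bound is uniform in `T`. -/
lemma storage_integral_le (hV : IsPrimitive v V) (hV0 : ∀ t, 0 ≤ t → 0 ≤ V t)
    (hg : IntegrableOn g (Ici 0)) (hg0 : ∀ t, 0 ≤ g t)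
    (hc : ContinuousOn c (Ici 0)) (hc0 : ∀ t, 0 ≤ t → 0 ≤ c t)
    (hv : ∀ t, 0 ≤ t → v t ≤ g t - c t) :
    IntegrableOn c (Ici 0) ∧ ∫ t in Ici (0 : ℝ), c t ≤ V 0 + ∫ t in Ici (0 : ℝ), g t := by
  refine integrableOn_Ici_of_integral_le hc hc0 fun T hT => ?_
  have hgi : IntervalIntegrable g volume 0 T :=
    (intervalIntegrable_iff_integrableOn_Icc_of_le hT).2 (hg.mono_set Icc_subset_Ici_self)
  have hci : IntervalIntegrable c volume 0 T := by
    refine ContinuousOn.intervalIntegrable ?_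
    rw [uIcc_of_le hT]
    exact hc.mono Icc_subset_Ici_self
  have h := hV.sub_le_integral le_rfl hT (hgi.sub hci) hv
  rw [intervalIntegral.integral_sub hgi hci] at h
  have h2 : ∫ t in (0 : ℝ)..T, g t ≤ ∫ t in Ici (0 : ℝ), g t := by
    rw [intervalIntegral.integral_of_le hT]
    exact setIntegral_mono_set hg (Eventually.of_forall hg0)
      (Ioc_subset_Icc_self.trans Icc_subset_Ici_self).eventuallyLE
  linarith [hV0 T hT]

/-- Since `ω V` is integrable, `V` is small at arbitrarily late times. After such a time it can grow
by no more than a tail of `∫ g`. -/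
lemma storage_tendsto_zero (hω : 0 < ω) (hV : IsPrimitive v V) (hV0 : ∀ t, 0 ≤ t → 0 ≤ V t)
    (hg : IntegrableOn g (Ici 0)) (hg0 : ∀ t, 0 ≤ g t)
    (hv : ∀ t, 0 ≤ t → v t ≤ g t - ω * V t) : Tendsto V atTop (𝓝 0) := by
  obtain ⟨hVi, -⟩ := storage_integral_le (c := fun t => ω * V t) hV hV0 hg hg0
    (continuousOn_const.mul hV.continuousOn) (fun t ht => mul_nonneg hω.le (hV0 t ht)) hv
  have hfreq (S ε : ℝ) (hε : 0 < ε) : ∃ a, 0 ≤ a ∧ S ≤ a ∧ V a < ε := by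
    -- Otherwise `ω V` would dominate a positive constant on a half-line of infinite measure.
    by_contra! hcon
    have hi : IntegrableOn (fun t => ω * V t) (Ici (max 0 S)) :=
      hVi.mono_set (Ici_subset_Ici.2 (le_max_left _ _))
    have hconst : IntegrableOn (fun _ : ℝ => ω * ε) (Ici (max 0 S)) := by
      refine Integrable.mono' hi aestronglyMeasurable_const ?_
      filter_upwards [ae_restrict_mem measurableSet_Ici] with t ht
      rw [Real.norm_of_nonneg (by positivity)]
      exact mul_le_mul_of_nonneg_left
        (hcon t ((le_max_left _ _).trans ht) ((le_max_right _ _).trans ht)) hω.le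
    rw [integrableOn_const_iff] at hconst
    simp [hω.ne', hε.ne'] at hconst
  have hG := intervalIntegral_tendsto_integral_Ioi 0
    ((integrableOn_Ici_iff_integrableOn_Ioi (by simp)).1 hg)
    tendsto_id
  rw [Metric.tendsto_atTop]
  intro ε hε
  -- Two partial integrals of `g` beyond `S` differ by less than `ε/2`; together with `V a < ε/4`
  -- this stays below `ε`.
  obtain ⟨S, hS⟩ := (Metric.tendsto_atTop.1 hG) (ε / 4) (by positivity)
  obtain ⟨a, ha0, haS, haV⟩ := hfreq S (ε / 4) (by positivity)
  refine ⟨a, fun t ht => ?_⟩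
  have ht0 := ha0.trans ht
  have hgi (b : ℝ) (hb : 0 ≤ b) : IntervalIntegrable g volume 0 b :=
    (intervalIntegrable_iff_integrableOn_Icc_of_le hb).2 (hg.mono_set Icc_subset_Ici_self)
  have h1 := hV.sub_le_integral ha0 ht ((hgi a ha0).symm.trans (hgi t ht0)) fun u hu =>
    (hv u hu).trans (sub_le_self _ (mul_nonneg hω.le (hV0 u hu)))
  rw [← intervalIntegral.integral_interval_sub_left (hgi t ht0) (hgi a ha0)] at h1
  have h2 := abs_lt.1 (hS a haS)
  have h3 := abs_lt.1 (hS t (haS.trans ht))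
  simp only [id] at h2 h3
  rw [Real.dist_eq, sub_zero, abs_of_nonneg (hV0 t ht0)]
  linarith [h2.1, h3.2]

end Storage

end SyncNetwork

/-! ### The storage function along solutions. -/

namespace SyncNetwork

variable {N n l r₀ : ℕ} {r m : Fin N → ℕ} {s h : Fin N → Fin N → ℕ}

/-- The product rule entry by entry; symmetry of `M` merges the two resulting terms. -/
lemma IsPrimitive.quad {k : ℕ} {M : Matrix (Fin k) (Fin k) ℝ} (hM : M.IsHermitian)
    {f e : ℝ → Fin k → ℝ} (he : ∀ a, IsPrimitive (fun t => f t a) fun t => e t a) :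
    IsPrimitive (fun t => 2 * (e t ⬝ᵥ M *ᵥ f t)) fun t => e t ⬝ᵥ M *ᵥ e t := by
  have h := IsPrimitive.sum Finset.univ fun a _ => IsPrimitive.sum Finset.univ fun b _ =>
    ((he a).mul (he b)).const_mul (M a b)
  convert h using 1 <;> funext t
  · have h1 : 2 * (e t ⬝ᵥ M *ᵥ f t) = f t ⬝ᵥ M *ᵥ e t + e t ⬝ᵥ M *ᵥ f t := by
      rw [dotProduct_mulVec_symm hM (f t)]
      ring
    rw [h1]
    simp only [dotProduct, Matrix.mulVec, Finset.mul_sum, ← Finset.sum_add_distrib]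
    exact Finset.sum_congr rfl fun a _ => Finset.sum_congr rfl fun b _ => by ring
  · simp only [dotProduct, Matrix.mulVec, Finset.mul_sum]
    exact Finset.sum_congr rfl fun a _ => Finset.sum_congr rfl fun b _ => by ring

lemma isPrimitive_apply {k : ℕ} {f x : ℝ → Vec k}
    (hf : ∀ t, 0 ≤ t → IntervalIntegrable f volume 0 t)
    (hx : ∀ t, 0 ≤ t → x t = x 0 + ∫ u in (0 : ℝ)..t, f u) (a : Fin k) :
    IsPrimitive (fun t => f t a) fun t => x t a where
  intervalIntegrable t ht :=
    ⟨(EuclideanSpace.proj (𝕜 := ℝ) a).integrable_comp (hf t ht).1,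
      (EuclideanSpace.proj (𝕜 := ℝ) a).integrable_comp (hf t ht).2⟩
  eq_integral t ht := by
    have h := (EuclideanSpace.proj (𝕜 := ℝ) a).intervalIntegral_comp_comm (hf t ht)
    rw [hx t ht, PiLp.add_apply]
    exact congrArg _ h.symm

/-- The constant is the minimum of the form on the compact unit sphere, extended by homogeneity.
Definiteness enters only the sign of `c`, so that applying the bound to `-M` also yields upper
bounds. -/
lemma exists_quad_lower_bound {k : ℕ} (M : Matrix (Fin k) (Fin k) ℝ) :
    ∃ c : ℝ, (∀ v : Fin k → ℝ, c * (v ⬝ᵥ v) ≤ v ⬝ᵥ M *ᵥ v) ∧ (M.PosDef → 0 < c) := by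
  rcases isEmpty_or_nonempty (Fin k) with hk | hk
  · exact ⟨1, fun v => by simp [dotProduct], fun _ => one_pos⟩
  have hcont : Continuous fun v : Vec k => v.ofLp ⬝ᵥ M *ᵥ v.ofLp := by
    simp only [dotProduct, Matrix.mulVec]
    fun_prop
  obtain ⟨u, hu, hmin⟩ := (isCompact_sphere (0 : Vec k) 1).exists_isMinOn
    (NormedSpace.sphere_nonempty.2 zero_le_one) hcont.continuousOn
  have hu1 : ‖u‖ = 1 := by simpa using hu
  refine ⟨u.ofLp ⬝ᵥ M *ᵥ u.ofLp, fun v => ?_, fun hM => ?_⟩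
  · set v' : Vec k := WithLp.toLp 2 v with hv'
    rcases eq_or_ne v' 0 with h0 | h0
    · have : v = 0 := by simpa [hv'] using h0
      simp [this]
    · have hn : 0 < ‖v'‖ := norm_pos_iff.2 h0
      have hmem : ‖v'‖⁻¹ • v' ∈ Metric.sphere (0 : Vec k) 1 := by
        simp [norm_smul, hn.ne']
      have h := hmin hmem
      have hvv : v ⬝ᵥ v = ‖v'‖ ^ 2 := (norm_sq_eq_dotProduct v').symm
      simp only [Set.mem_ofPred_eq, WithLp.ofLp_smul, Matrix.mulVec_smul, dotProduct_smul,
        smul_dotProduct, smul_eq_mul] at h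
      rw [hvv]
      calc _ ≤ (‖v'‖⁻¹ * (‖v'‖⁻¹ * (v ⬝ᵥ M *ᵥ v))) * ‖v'‖ ^ 2 := by gcongr
        _ = _ := by field_simp
  · have hne : u.ofLp ≠ 0 := fun h0 => by
      have : u = 0 := by ext a; simp [h0]
      simp [this] at hu1
    simpa using hM.dotProduct_mulVec_pos hne

lemma exists_pos_le {ι : Type*} [Finite ι] {f : ι → ℝ} (hf : ∀ i, 0 < f i) :
    ∃ c, 0 < c ∧ ∀ i, c ≤ f i := by
  rcases isEmpty_or_nonempty ι with hι | hι
  · exact ⟨1, one_pos, fun i => hι.elim i⟩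
  · obtain ⟨i, hi⟩ := Finite.exists_min f
    exact ⟨f i, hf i, hi⟩

lemma posDef_blockDiagonal {ι κ : Type*} [Fintype ι] [Fintype κ] [DecidableEq κ]
    {M : κ → Matrix ι ι ℝ} (hM : ∀ k, (M k).PosDef) : (Matrix.blockDiagonal M).PosDef := by
  refine .of_dotProduct_mulVec_pos ?_ fun x hx => ?_
  · rw [Matrix.IsHermitian, Matrix.blockDiagonal_conjTranspose]
    exact congrArg _ (funext fun k => (hM k).isHermitian)
  · have h := blockDiagonal_dotProduct M fun k a => x (a, k)
    rw [star_trivial]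
    refine lt_of_lt_of_eq ?_ h.symm
    have hnn (k : κ) : 0 ≤ (fun a => x (a, k)) ⬝ᵥ M k *ᵥ fun a => x (a, k) := by
      simpa using (hM k).posSemidef.dotProduct_mulVec_nonneg fun a => x (a, k)
    obtain ⟨⟨a, k⟩, hak⟩ := Function.ne_iff.1 hx
    refine Finset.sum_pos' (fun k _ => hnn k) ⟨k, Finset.mem_univ _, ?_⟩
    have hne : (fun a => x (a, k)) ≠ 0 := fun h0 => hak (congrFun h0 a)
    simpa using (hM k).dotProduct_mulVec_pos hne

namespace Network

variable (net : Network N n l r₀ r m s h)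

/-- The error equation: `x_j - x_i = e_i - e_j`, so the protocol depends on errors and noises only,
and the state enters otherwise through the increments of `φ` and `ψ`. -/
lemma leaderRHS_sub_agentRHS {ρ : ℝ} {K : ∀ i j, Matrix (Fin n) (Fin (h i j)) ℝ}
    {L : ∀ i, Matrix (Fin n) (Fin (m i)) ℝ} {ψ : ℝ → Vec n → Vec n}
    {w₀ : ℝ → Vec r₀} {w : ∀ i, ℝ → Vec (r i)} {wc : ∀ i j, ℝ → Vec (s i j)}
    {x : ℝ → Vec n} {xs : Fin N → ℝ → Vec n} (i : Fin N) (t : ℝ) :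
    (net.leaderRHS ρ ψ w₀ x t - net.agentRHS ρ K L ψ w wc x xs i t).ofLp
      = net.A ρ *ᵥ (x t - xs i t).ofLp + net.B₁ *ᵥ (net.φ (x t) - net.φ (xs i t)).ofLp
        + net.B₂₀ *ᵥ (w₀ t).ofLp + (ψ t (x t) - ψ t (xs i t)).ofLp
        - L i *ᵥ (net.C₂ i *ᵥ (x t - xs i t).ofLp + net.D₂ i *ᵥ (w i t).ofLp)
        - ∑ j ∈ net.nbr i, K i j *ᵥ (net.H i j *ᵥ ((x t - xs i t).ofLp - (x t - xs j t).ofLp)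
            + net.G i j *ᵥ (wc i j t).ofLp)
        - net.B₂ i *ᵥ (w i t).ofLp := by
  have hsub (j : Fin N) : (x t - xs i t).ofLp - (x t - xs j t).ofLp
      = (xs j t).ofLp - (xs i t).ofLp := by simp
  simp only [hsub]
  simp only [leaderRHS, agentRHS, control, meas, msg, act, WithLp.ofLp_sub, WithLp.ofLp_add,
    WithLp.ofLp_sum, Matrix.mulVec_sub, Matrix.mulVec_add, Finset.sum_add_distrib,
    Finset.sum_sub_distrib]
  abel

variable {R : Matrix (Fin n) (Fin n) ℝ} {ρ α γ : ℝ} {δ : Fin N → ℝ}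
  {Q : Fin N → Matrix (Fin n) (Fin n) ℝ} {τ θ : Fin N → ℝ}
  {X : Fin N → Matrix (Fin n) (Fin n) ℝ} {ψ : ℝ → Vec n → Vec n}
  {w₀ : ℝ → Vec r₀} {w : ∀ i, ℝ → Vec (r i)} {wc : ∀ i j, ℝ → Vec (s i j)}
  {x : ℝ → Vec n} {xs : Fin N → ℝ → Vec n}

/-- Along solutions the storage function `∑ e_i' X_i e_i` is locally absolutely continuous, and
its derivative obeys the dissipation inequality. -/
lemma exists_storage_deriv
    (hLip : ∀ a b : Vec n, ‖net.φ a - net.φ b‖ ^ 2 ≤ quad R (a - b).ofLp)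
    (hE : ∀ i, (net.E₂ i).PosDef) (hF : ∀ i, ∀ j ∈ net.nbr i, (net.F i j).PosDef)
    (hfeas : net.Feasible R ρ α γ δ Q τ θ X) (hψ : MismatchBound α ψ)
    (hsol : net.IsSolution ρ (net.gainK γ X) (net.gainL γ X) ψ w₀ w wc x xs) :
    ∃ v : ℝ → ℝ,
      IsPrimitive v (fun t => ∑ i, quad (X i) (x t - xs i t).ofLp) ∧
      ∀ t, 0 ≤ t → v t ≤ γ ^ 2 * (N * ‖w₀ t‖ ^ 2 + ∑ i, (‖w i t‖ ^ 2 + ∑ j, ‖wc i j t‖ ^ 2))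
        - (∑ i, quad (Q i) (x t - xs i t).ofLp
            + ∑ i, ∑ j ∈ net.nbr i, ‖(x t - xs j t) - (x t - xs i t)‖ ^ 2)
        - ∑ i, 2 * δ i / ((net.outDeg i : ℝ) + 1) * quad (X i) (x t - xs i t).ofLp := by
  refine ⟨_, IsPrimitive.sum Finset.univ fun i _ => IsPrimitive.quad (hfeas i).2.2.1.isHermitian
    (f := fun t => (net.leaderRHS ρ ψ w₀ x t
      - net.agentRHS ρ (net.gainK γ X) (net.gainL γ X) ψ w wc x xs i t).ofLp) fun a => ?_,
    fun t ht => ?_⟩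
  · exact (isPrimitive_apply hsol.leader_int hsol.leader_eq a).sub
      (isPrimitive_apply (hsol.agent_int i) (hsol.agent_eq i) a)
  · simp only [leaderRHS_sub_agentRHS]
    simp only [norm_sq_eq_dotProduct]
    refine net.network_dissipation hE hF hfeas (fun i => (x t - xs i t).ofLp) (fun i => ?_)
      (fun i => ?_) _ _ _
    · rw [← norm_sq_eq_dotProduct]
      exact hLip _ _
    · rw [← norm_sq_eq_dotProduct, ← norm_sq_eq_dotProduct]
      exact hψ t ht _ _

end Network

end SyncNetwork

/-! ### Disturbance energy, running cost and the synchronization theorem. -/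

namespace SyncNetwork

variable {N n l r₀ : ℕ} {r m : Fin N → ℕ} {s h : Fin N → Fin N → ℕ}

lemma IsL2.integrableOn {k : ℕ} {f : ℝ → Vec k} (hf : IsL2 f) :
    IntegrableOn (fun t => ‖f t‖ ^ 2) (Ici 0) :=
  MemLp.integrable_norm_pow hf two_ne_zero

lemma l2sq_nonneg {k : ℕ} (f : ℝ → Vec k) : 0 ≤ l2sq f :=
  integral_nonneg fun _ => by positivity

/-- The squared norm of all disturbances at time `t`, with weight `N` on `w₀`. -/
noncomputable def distSq (w₀ : ℝ → Vec r₀) (w : ∀ i, ℝ → Vec (r i)) (wc : ∀ i j, ℝ → Vec (s i j))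
    (t : ℝ) : ℝ :=
  N * ‖w₀ t‖ ^ 2 + ∑ i, (‖w i t‖ ^ 2 + ∑ j, ‖wc i j t‖ ^ 2)

lemma distSq_nonneg (w₀ : ℝ → Vec r₀) (w : ∀ i, ℝ → Vec (r i)) (wc : ∀ i j, ℝ → Vec (s i j))
    (t : ℝ) : 0 ≤ distSq w₀ w wc t := by
  unfold distSq
  positivity

lemma DistL2.integral_distSq {w₀ : ℝ → Vec r₀} {w : ∀ i, ℝ → Vec (r i)}
    {wc : ∀ i j, ℝ → Vec (s i j)} (hw : DistL2 w₀ w wc) :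
    IntegrableOn (distSq w₀ w wc) (Ici 0) ∧
      ∫ t in Ici (0 : ℝ), distSq w₀ w wc t
        = N * l2sq w₀ + ∑ i, (l2sq (w i) + ∑ j, l2sq (wc i j)) := by
  obtain ⟨h0, h1, h2⟩ := hw
  have hi0 : IntegrableOn (fun t => (N : ℝ) * ‖w₀ t‖ ^ 2) (Ici 0) := h0.integrableOn.const_mul _
  have hi2 (i : Fin N) : IntegrableOn (fun t => ∑ j, ‖wc i j t‖ ^ 2) (Ici 0) :=
    integrable_finsetSum _ fun j _ => (h2 i j).integrableOn
  have hi1 (i : Fin N) : IntegrableOn (fun t => ‖w i t‖ ^ 2 + ∑ j, ‖wc i j t‖ ^ 2) (Ici 0) :=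
    (h1 i).integrableOn.add (hi2 i)
  have hi3 : IntegrableOn (fun t => ∑ i, (‖w i t‖ ^ 2 + ∑ j, ‖wc i j t‖ ^ 2)) (Ici 0) :=
    integrable_finsetSum _ fun i _ => hi1 i
  refine ⟨hi0.add hi3, ?_⟩
  unfold distSq
  rw [integral_add hi0 hi3, integral_const_mul, integral_finsetSum _ fun i _ => hi1 i]
  congr 1
  refine Finset.sum_congr rfl fun i _ => ?_
  rw [integral_add (h1 i).integrableOn (hi2 i),
    integral_finsetSum _ fun j _ => (h2 i j).integrableOn]
  rfl

lemma quad_blockDiagonal_stack (M : Fin N → Matrix (Fin n) (Fin n) ℝ) (z : Fin N → Vec n) :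
    quad (Matrix.blockDiagonal M) (stack z) = ∑ i, quad (M i) (z i).ofLp :=
  blockDiagonal_dotProduct M fun i => (z i).ofLp

lemma quad_nonneg {k : ℕ} {M : Matrix (Fin k) (Fin k) ℝ} (hM : M.PosDef) (v : Fin k → ℝ) :
    0 ≤ quad M v := by
  simpa [quad] using hM.posSemidef.dotProduct_mulVec_nonneg v

lemma exists_quad_bounds {M : Fin N → Matrix (Fin n) (Fin n) ℝ} (hM : ∀ i, (M i).PosDef) :
    ∃ a > 0, ∃ b > 0, ∀ i (v : Vec n), a * ‖v‖ ^ 2 ≤ quad (M i) v.ofLp ∧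
      quad (M i) v.ofLp ≤ b * ‖v‖ ^ 2 := by
  choose c hc hc0 using fun i => exists_quad_lower_bound (M i)
  choose d hd _ using fun i => exists_quad_lower_bound (-M i)
  obtain ⟨a, ha, hac⟩ := exists_pos_le fun i => hc0 i (hM i)
  -- The sum dominates every `-d i`; the summand `1` keeps the constant positive in all cases.
  refine ⟨a, ha, 1 + ∑ i, |d i|, by positivity, fun i v => ⟨?_, ?_⟩⟩
  · refine le_trans ?_ (hc i v.ofLp)
    rw [← norm_sq_eq_dotProduct]
    gcongr
    exact hac i
  · have h1 := hd i v.ofLp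
    rw [← norm_sq_eq_dotProduct, Matrix.neg_mulVec, dotProduct_neg] at h1
    have h2 : -d i ≤ 1 + ∑ i, |d i| := by
      have := Finset.single_le_sum (f := fun i => |d i|) (fun _ _ => abs_nonneg _)
        (Finset.mem_univ i)
      linarith [neg_abs_le (d i)]
    have h3 := mul_le_mul_of_nonneg_right h2 (sq_nonneg ‖v‖)
    unfold quad
    linarith

namespace Network

variable (net : Network N n l r₀ r m s h)

variable {R : Matrix (Fin n) (Fin n) ℝ} {ρ α γ : ℝ} {δ : Fin N → ℝ}
  {Q : Fin N → Matrix (Fin n) (Fin n) ℝ} {τ θ : Fin N → ℝ}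
  {X : Fin N → Matrix (Fin n) (Fin n) ℝ} {ψ : ℝ → Vec n → Vec n}
  {w₀ : ℝ → Vec r₀} {w : ∀ i, ℝ → Vec (r i)} {wc : ∀ i j, ℝ → Vec (s i j)}
  {x : ℝ → Vec n} {xs : Fin N → ℝ → Vec n}

/-- The running cost multiplied by the number of agents. -/
noncomputable def costRate (Q : Fin N → Matrix (Fin n) (Fin n) ℝ) (z : Fin N → Vec n) : ℝ :=
  ∑ i, quad (Q i) (z i).ofLp + ∑ i, ∑ j ∈ net.nbr i, ‖z j - z i‖ ^ 2

lemma cost_eq (Q : Fin N → Matrix (Fin n) (Fin n) ℝ) (z : Fin N → Vec n) :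
    1 / (N : ℝ) * quad (Matrix.blockDiagonal Q) (stack z) + net.disagreement z
      = 1 / (N : ℝ) * net.costRate Q z := by
  rw [quad_blockDiagonal_stack, disagreement, costRate, mul_add]

lemma costRate_nonneg (hQ : ∀ i, (Q i).PosDef) (z : Fin N → Vec n) : 0 ≤ net.costRate Q z :=
  add_nonneg (Finset.sum_nonneg fun i _ => quad_nonneg (hQ i) _)
    (Finset.sum_nonneg fun i _ => Finset.sum_nonneg fun j _ => by positivity)

lemma continuous_costRate (Q : Fin N → Matrix (Fin n) (Fin n) ℝ) :
    Continuous (net.costRate Q) := by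
  unfold costRate quad
  simp only [dotProduct, Matrix.mulVec]
  fun_prop

lemma IsSolution.continuousOn_error {K : ∀ i j, Matrix (Fin n) (Fin (h i j)) ℝ}
    {L : ∀ i, Matrix (Fin n) (Fin (m i)) ℝ}
    (hsol : net.IsSolution ρ K L ψ w₀ w wc x xs) :
    ContinuousOn (fun t i => x t - xs i t) (Ici 0) := by
  refine continuousOn_pi.2 fun i => ?_
  have hc {k : ℕ} {f y : ℝ → Vec k} (hf : ∀ t, 0 ≤ t → IntervalIntegrable f volume 0 t)
      (hy : ∀ t, 0 ≤ t → y t = y 0 + ∫ u in (0 : ℝ)..t, f u) : ContinuousOn y (Ici 0) :=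
    (PiLp.continuous_toLp 2 _).comp_continuousOn
      (continuousOn_pi.2 fun a => (isPrimitive_apply hf hy a).continuousOn)
  exact (hc hsol.leader_int hsol.leader_eq).sub (hc (hsol.agent_int i) (hsol.agent_eq i))

/-- Feasibility of the LMIs yields strong robust synchronization, with any weight
`diag[κ X_i]` for which `γ² κ N ≥ 1`. -/
theorem strongSync_of_feasible
    (hLip : ∀ a b : Vec n, ‖net.φ a - net.φ b‖ ^ 2 ≤ quad R (a - b).ofLp)
    (hE : ∀ i, (net.E₂ i).PosDef) (hF : ∀ i, ∀ j ∈ net.nbr i, (net.F i j).PosDef)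
    (hδ : ∀ i, 0 < δ i) (hQ : ∀ i, (Q i).PosDef) (hfeas : net.Feasible R ρ α γ δ Q τ θ X)
    {κ : ℝ} (hκ : 0 < N → 0 < κ ∧ 1 ≤ γ ^ 2 * κ * N) :
    StrongSync net ρ α γ Q (net.gainK γ X) (net.gainL γ X)
      (Matrix.blockDiagonal fun i => κ • X i) := by
  have hX (i : Fin N) : (X i).PosDef := (hfeas i).2.2.1
  have hP : (Matrix.blockDiagonal fun i => κ • X i).PosDef :=
    posDef_blockDiagonal fun i => (hX i).smul (hκ i.pos).1
  -- The decay rate is a common lower bound of the surviving shares `2δ_i/(q_i+1)`; like `a` and `b`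
  -- below it does not depend on `ψ`, as the uniformity in (i) requires.
  obtain ⟨ω, hω, hωδ⟩ := exists_pos_le (f := fun i => 2 * δ i / ((net.outDeg i : ℝ) + 1))
    fun i => div_pos (mul_pos two_pos (hδ i)) (by positivity)
  obtain ⟨a, ha, b, hb, hab⟩ := exists_quad_bounds hX
  have hVnn (x : ℝ → Vec n) (xs : Fin N → ℝ → Vec n) (t : ℝ) :
      0 ≤ ∑ i, quad (X i) (x t - xs i t).ofLp :=
    Finset.sum_nonneg fun i _ => quad_nonneg (hX i) _
  have hstorage {ψ : ℝ → Vec n → Vec n} {w₀ : ℝ → Vec r₀} {w : ∀ i, ℝ → Vec (r i)}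
      {wc : ∀ i j, ℝ → Vec (s i j)} {x : ℝ → Vec n} {xs : Fin N → ℝ → Vec n}
      (hψ : MismatchBound α ψ)
      (hsol : net.IsSolution ρ (net.gainK γ X) (net.gainL γ X) ψ w₀ w wc x xs) :
      ∃ v : ℝ → ℝ, IsPrimitive v (fun t => ∑ i, quad (X i) (x t - xs i t).ofLp) ∧
        ∀ t, 0 ≤ t → v t ≤ γ ^ 2 * distSq w₀ w wc t - net.costRate Q (fun i => x t - xs i t)
          - ω * ∑ i, quad (X i) (x t - xs i t).ofLp := by
    obtain ⟨v, hv, hle⟩ := net.exists_storage_deriv hLip hE hF hfeas hψ hsol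
    refine ⟨v, hv, fun t ht => (hle t ht).trans (sub_le_sub_left ?_ _)⟩
    rw [Finset.mul_sum]
    exact Finset.sum_le_sum fun i _ => mul_le_mul_of_nonneg_right (hωδ i) (quad_nonneg (hX i) _)
  have hcost {ψ : ℝ → Vec n → Vec n} {w₀ : ℝ → Vec r₀} {w : ∀ i, ℝ → Vec (r i)}
      {wc : ∀ i j, ℝ → Vec (s i j)} {x : ℝ → Vec n} {xs : Fin N → ℝ → Vec n}
      (hψ : MismatchBound α ψ) (hw : DistL2 w₀ w wc)
      (hsol : net.IsSolution ρ (net.gainK γ X) (net.gainL γ X) ψ w₀ w wc x xs) :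
      IntegrableOn (fun t => net.costRate Q fun i => x t - xs i t) (Ici 0) ∧
      ∫ t in Ici (0 : ℝ), net.costRate Q (fun i => x t - xs i t)
        ≤ ∑ i, quad (X i) (x 0 - xs i 0).ofLp
          + γ ^ 2 * (N * l2sq w₀ + ∑ i, (l2sq (w i) + ∑ j, l2sq (wc i j))) := by
    obtain ⟨v, hv, hle⟩ := hstorage hψ hsol
    have h := storage_integral_le hv (fun t _ => hVnn x xs t)
      (hw.integral_distSq.1.const_mul (γ ^ 2))
      (fun t => mul_nonneg (sq_nonneg γ) (distSq_nonneg w₀ w wc t))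
      ((net.continuous_costRate Q).comp_continuousOn (hsol.continuousOn_error net))
      (fun t _ => net.costRate_nonneg hQ _)
      (fun t ht => (hle t ht).trans (sub_le_self _ (mul_nonneg hω.le (hVnn x xs t))))
    rw [integral_const_mul, hw.integral_distSq.2] at h
    exact h
  refine ⟨hP, ⟨b / a, by positivity, ω, hω, fun ψ hψ x xs hsol i t ht => ?_⟩,
    fun ψ hψ w₀ w wc hw x xs hsol => ?_, fun ψ hψ w₀ w wc hw x xs hsol hne => ?_,
    fun ψ hψ w₀ w wc hw x xs hsol => ?_⟩
  · obtain ⟨v, hv, hle⟩ := hstorage hψ hsol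
    have h := storage_exp_decay hv (ω := ω) (fun u hu => (hle u hu).trans (by
      have := net.costRate_nonneg hQ fun i => x u - xs i u
      simp only [distSq, norm_zero, ne_eq, OfNat.ofNat_ne_zero, not_false_eq_true, zero_pow,
        mul_zero, Finset.sum_const_zero, add_zero, zero_sub]
      linarith)) ht
    have h1 : a * ‖xs i t - x t‖ ^ 2 ≤ ∑ i, quad (X i) (x t - xs i t).ofLp := by
      rw [norm_sub_rev]
      exact ((hab i _).1).trans (Finset.single_le_sum
        (f := fun i => quad (X i) (x t - xs i t).ofLp) (fun i _ => quad_nonneg (hX i) _)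
        (Finset.mem_univ i))
    have h2 : ∑ i, quad (X i) (x 0 - xs i 0).ofLp ≤ b * ∑ k, ‖xs k 0 - x 0‖ ^ 2 := by
      rw [Finset.mul_sum]
      refine Finset.sum_le_sum fun k _ => ?_
      rw [norm_sub_rev]
      exact (hab k _).2
    have h3 := (h1.trans h).trans (mul_le_mul_of_nonneg_right h2 (Real.exp_pos (-ω * t)).le)
    rw [div_mul_eq_mul_div, div_mul_eq_mul_div, le_div_iff₀ ha]
    linarith
  · simp only [cost_eq]
    exact (hcost hψ hw hsol).1.const_mul _
  · have hdata : dataNormSq (Matrix.blockDiagonal fun i => κ • X i) (fun i => x 0 - xs i 0) w₀ w wc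
        = κ * ∑ i, quad (X i) (x 0 - xs i 0).ofLp + l2sq w₀
          + 1 / (N : ℝ) * ∑ i, (l2sq (w i) + ∑ j, l2sq (wc i j)) := by
      rw [dataNormSq, quad_blockDiagonal_stack]
      simp only [quad, Matrix.smul_mulVec, dotProduct_smul, smul_eq_mul, ← Finset.mul_sum]
    have hV0 := hVnn x xs 0
    have hw0 := l2sq_nonneg w₀
    have hws : 0 ≤ ∑ i, (l2sq (w i) + ∑ j, l2sq (wc i j)) :=
      Finset.sum_nonneg fun i _ => add_nonneg (l2sq_nonneg _)
        (Finset.sum_nonneg fun j _ => l2sq_nonneg _)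
    simp only [cost_eq, integral_const_mul]
    -- Without agents the cost is zero, and so is the ratio.
    rcases Nat.eq_zero_or_pos N with hN | hN
    · subst hN
      simp [sq_nonneg]
    obtain ⟨hκ0, hκ1⟩ := hκ hN
    have hN' : (0 : ℝ) < N := Nat.cast_pos.2 hN
    rw [hdata] at hne ⊢
    have hpos := lt_of_le_of_ne (add_nonneg (add_nonneg (mul_nonneg hκ0.le hV0) hw0)
      (mul_nonneg (one_div_nonneg.2 hN'.le) hws)) hne.symm
    rw [div_le_iff₀ hpos, one_div_mul_eq_div, div_le_iff₀ hN']
    refine (hcost hψ hw hsol).2.trans ?_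
    generalize ∑ i, quad (X i) (x 0 - xs i 0).ofLp = V at hV0 ⊢
    generalize ∑ i, (l2sq (w i) + ∑ j, l2sq (wc i j)) = W
    -- The condition `γ² κ N ≥ 1` replaces `V(0)` by `γ² N` times its weighted version `κ V(0)`, so
    -- that the whole bound becomes `γ² N` times the data norm.
    have h1 := mul_le_mul_of_nonneg_right hκ1 hV0
    have h2 : (N : ℝ) * (1 / N * W) = W := by field_simp
    calc _ ≤ γ ^ 2 * κ * N * V + γ ^ 2 * (N * l2sq w₀ + W) := by linarith
      _ = γ ^ 2 * κ * N * V + γ ^ 2 * (N * l2sq w₀ + N * (1 / N * W)) := by rw [h2]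
      _ = _ := by ring
  · obtain ⟨v, hv, hle⟩ := hstorage hψ hsol
    have h := storage_tendsto_zero hω hv (fun t _ => hVnn x xs t)
      (hw.integral_distSq.1.const_mul (γ ^ 2))
      (fun t => mul_nonneg (sq_nonneg γ) (distSq_nonneg w₀ w wc t))
      (fun t ht => (hle t ht).trans
        (sub_le_sub_right (sub_le_self _ (net.costRate_nonneg hQ _)) _))
    refine squeeze_zero (fun t => Finset.sum_nonneg fun i _ => sq_nonneg _) (fun t => ?_)
      (by simpa using h.const_mul a⁻¹)
    rw [Finset.mul_sum]
    refine Finset.sum_le_sum fun i _ => ?_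
    rw [← div_eq_inv_mul, le_div_iff₀ ha, mul_comm]
    exact (hab i _).1

end Network

end SyncNetwork

theorem lemma1 {N n l r₀ : ℕ} {r m : Fin N → ℕ} {s h : Fin N → Fin N → ℕ}
    (net : SyncNetwork.Network N n l r₀ r m s h)
    (R : Matrix (Fin n) (Fin n) ℝ) (hR : R.PosSemidef)
    (hLip : ∀ a b : SyncNetwork.Vec n,
      ‖net.φ a - net.φ b‖ ^ 2 ≤ SyncNetwork.quad R (a - b).ofLp)
    (hE : ∀ i, (net.E₂ i).PosDef)
    (hF : ∀ i, ∀ j ∈ net.nbr i, (net.F i j).PosDef)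
    (ρ α γ : ℝ) (hα : 0 < α) (hγ : 0 < γ)
    (δ : Fin N → ℝ) (hδ : ∀ i, 0 < δ i)
    (Q : Fin N → Matrix (Fin n) (Fin n) ℝ) (hQ : ∀ i, (Q i).PosDef)
    (τ θ : Fin N → ℝ) (X : Fin N → Matrix (Fin n) (Fin n) ℝ)
    (hfeas : net.Feasible R ρ α γ δ Q τ θ X) :
    SyncNetwork.StrongSync net ρ α γ Q (net.gainK γ X) (net.gainL γ X)
        (Matrix.blockDiagonal fun i => (1 / (γ ^ 2 * (N : ℝ))) • X i) ∧
      (1 ≤ γ → SyncNetwork.StrongSync net ρ α γ Q (net.gainK γ X) (net.gainL γ X)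
        (Matrix.blockDiagonal fun i => (1 / (N : ℝ)) • X i)) := by
  have hγ2 : 0 < γ ^ 2 := by positivity
  refine ⟨net.strongSync_of_feasible hLip hE hF hδ hQ hfeas fun hN => ?_,
    fun hγ1 => net.strongSync_of_feasible hLip hE hF hδ hQ hfeas fun hN => ?_⟩
  · have hN' : (0 : ℝ) < N := Nat.cast_pos.2 hN
    -- For `κ = 1/(γ² N)` the condition `γ² κ N ≥ 1` is an equality; for `κ = 1/N` below it reads
    -- `γ² ≥ 1`.
    refine ⟨by positivity, le_of_eq ?_⟩
    field_simp
  · have hN' : (0 : ℝ) < N := Nat.cast_pos.2 hN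
    refine ⟨by positivity, ?_⟩
    rw [mul_assoc, one_div_mul_cancel hN'.ne', mul_one]
    exact one_le_pow₀ hγ1
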